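/- For an abelian category $\mathcal N$, a binary acyclic complex of length $2$ (binary short exact sequence) is a diagram $\mathbb P\colon P_2 \underset{j}{\overset{i}{\rightrightarrows}} P_1 \underset{q}{\overset{p}{\rightrightarrows}} P_0$ in $\mathcal N$ such that both the top sequence $0\to P_2\xrightarrow{i}P_1\xrightarrow{p}P_0\to 0$ and the bottom sequence $0\to P_2\xrightarrow{j}P_1\xrightarrow{q}P_0\to 0$ are exact. Let $K_1(\mathcal N)$ denote Nenashev's $K_1$-group, i.e. the abelian group generated by all binary acyclic complexes of length $2$ in $\mathcal N$ subject to the relations: (1) $\mathbb P=0$ if $i=j$ and $p=q$; (2) $\mathbb P_0-\mathbb P_1+\mathbb P_2=\mathbb P'-\mathbb P+\mathbb P''$ for every $3\times 3$-diagram with rows $\mathbb P',\mathbb P,\mathbb P''$ (from top to bottom) and columns $\mathbb P_2,\mathbb P_1,\mathbb P_0$ (from left to right) in which all rows and columns are binary acyclic complexes of length $2$, top differentials commute with top differentials and bottom differentials commute with bottom differentials. Let $\mathcal A$ be a small abelian category in which every object has finite length, let $\mathcal B\subseteq\mathcal A$ be the full (abelian) subcategory of semisimple objects, and let $c\colon K_1(\mathcal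 B)\to K_1(\mathcal A)$ be the homomorphism induced by the exact inclusion. Let $M'\underset{j}{\overset{i}{\rightrightarrows}} M\underset{q}{\overset{p}{\rightrightarrows}} M''$ be a binary short exact sequence in $\mathcal A$ with $\mathrm{length}(M)\le 6$, let $x\in K_1(\mathcal A)$ be its class, and let $U:=i(M')\cap j(M')$. Then: (a) If $\mathrm{length}(M')=\mathrm{length}(M'')=3$, then $U$ is simple if and only if $M/(i(M')+j(M'))$ is simple. (b) $x$ belongs to the image of $c$, except possibly when $\mathrm{length}(M')=\mathrm{length}(M'')=3$, $U$ is simple, and both $i^{-1}(U)\cap j^{-1}(U)$ and $M''/(pj(M')+qi(M'))$ vanish. -/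

import Mathlib

open CategoryTheory CategoryTheory.Limits

attribute [local instance] Abelian.hasFiniteBiproducts

universe v u v' u'

/-! ### Binary short exact sequences and Nenashev's `K₁` -/

/-- `i, j : M' ⇉ M` and `p, q : M ⇉ M''` form a binary short exact sequence: both the top sequence
`0 ⟶ M' -i⟶ M -p⟶ M'' ⟶ 0` and the bottom sequence `0 ⟶ M' -j⟶ M -q⟶ M'' ⟶ 0` are short exact. -/
structure IsBinaryShortExact {C : Type u} [Category.{v} C] [Abelian C] {M' M M'' : C}
    (i j : M' ⟶ M) (p q : M ⟶ M'') : Prop where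
  zero_top : i ≫ p = 0
  zero_bot : j ≫ q = 0
  shortExact_top : (ShortComplex.mk i p zero_top).ShortExact
  shortExact_bot : (ShortComplex.mk j q zero_bot).ShortExact

/-- A binary acyclic complex of length 2 (supported on `[0, 2]`) in `C`. -/
structure BinarySES (C : Type u) [Category.{v} C] [Abelian C] where
  /-- the object in degree 2 -/
  X₂ : C
  /-- the object in degree 1 -/
  X₁ : C
  /-- the object in degree 0 -/
  X₀ : C
  /-- the top differential from degree 2 to degree 1 -/
  i : X₂ ⟶ X₁
  /-- the bottom differential from degree 2 to degree 1 -/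
  j : X₂ ⟶ X₁
  /-- the top differential from degree 1 to degree 0 -/
  p : X₁ ⟶ X₀
  /-- the bottom differential from degree 1 to degree 0 -/
  q : X₁ ⟶ X₀
  isBinaryShortExact : IsBinaryShortExact i j p q

namespace BinarySES

variable {C : Type u} [Category.{v} C] [Abelian C] {D : Type u'} [Category.{v'} D] [Abelian D]

/-- A binary complex is diagonal if its top and bottom differentials agree. -/
def IsDiagonal (P : BinarySES C) : Prop := P.i = P.j ∧ P.p = P.q

/-- A `3 × 3`-diagram whose rows and columns are binary acyclic complexes of length 2 and in which
top differentials commute with top differentials and bottom differentials commute with bottom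
differentials. The rows are `P'`, `P`, `P''` (from top to bottom); in column `k` the vertical
maps are `fₖ, gₖ : P'ₖ ⇉ Pₖ` and `aₖ, bₖ : Pₖ ⇉ P''ₖ`, where `fₖ`, `aₖ` are the top differentials
and `gₖ`, `bₖ` the bottom ones. -/
structure Diagram (P' P P'' : BinarySES C) where
  f₂ : P'.X₂ ⟶ P.X₂
  g₂ : P'.X₂ ⟶ P.X₂
  a₂ : P.X₂ ⟶ P''.X₂
  b₂ : P.X₂ ⟶ P''.X₂
  f₁ : P'.X₁ ⟶ P.X₁
  g₁ : P'.X₁ ⟶ P.X₁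
  a₁ : P.X₁ ⟶ P''.X₁
  b₁ : P.X₁ ⟶ P''.X₁
  f₀ : P'.X₀ ⟶ P.X₀
  g₀ : P'.X₀ ⟶ P.X₀
  a₀ : P.X₀ ⟶ P''.X₀
  b₀ : P.X₀ ⟶ P''.X₀
  exact₂ : IsBinaryShortExact f₂ g₂ a₂ b₂
  exact₁ : IsBinaryShortExact f₁ g₁ a₁ b₁
  exact₀ : IsBinaryShortExact f₀ g₀ a₀ b₀
  comm_top_i : P'.i ≫ f₁ = f₂ ≫ P.i
  comm_top_p : P'.p ≫ f₀ = f₁ ≫ P.p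
  comm_top_i' : P.i ≫ a₁ = a₂ ≫ P''.i
  comm_top_p' : P.p ≫ a₀ = a₁ ≫ P''.p
  comm_bot_j : P'.j ≫ g₁ = g₂ ≫ P.j
  comm_bot_q : P'.q ≫ g₀ = g₁ ≫ P.q
  comm_bot_j' : P.j ≫ b₁ = b₂ ≫ P''.j
  comm_bot_q' : P.q ≫ b₀ = b₁ ≫ P''.q

namespace Diagram

variable {P' P P'' : BinarySES C} (E : Diagram P' P P'')

/-- The column of the diagram in degree 2. -/
def col₂ : BinarySES C := ⟨_, _, _, E.f₂, E.g₂, E.a₂, E.b₂, E.exact₂⟩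

/-- The column of the diagram in degree 1. -/
def col₁ : BinarySES C := ⟨_, _, _, E.f₁, E.g₁, E.a₁, E.b₁, E.exact₁⟩

/-- The column of the diagram in degree 0. -/
def col₀ : BinarySES C := ⟨_, _, _, E.f₀, E.g₀, E.a₀, E.b₀, E.exact₀⟩

end Diagram

/-- The image of a binary short exact sequence under an exact functor. -/
def map (F : C ⥤ D) [F.Additive] [PreservesFiniteLimits F] [PreservesFiniteColimits F]
    (P : BinarySES C) : BinarySES D where
  X₂ := F.obj P.X₂
  X₁ := F.obj P.X₁
  X₀ := F.obj P.X₀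
  i := F.map P.i
  j := F.map P.j
  p := F.map P.p
  q := F.map P.q
  isBinaryShortExact :=
    { zero_top := by rw [← F.map_comp, P.isBinaryShortExact.zero_top, F.map_zero]
      zero_bot := by rw [← F.map_comp, P.isBinaryShortExact.zero_bot, F.map_zero]
      shortExact_top := P.isBinaryShortExact.shortExact_top.map_of_exact F
      shortExact_bot := P.isBinaryShortExact.shortExact_bot.map_of_exact F }

/-- The image of a `3 × 3`-diagram under an exact functor. -/
def Diagram.map (F : C ⥤ D) [F.Additive] [PreservesFiniteLimits F] [PreservesFiniteColimits F]
    {P' P P'' : BinarySES C} (E : Diagram P' P P'') :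
    Diagram (P'.map F) (P.map F) (P''.map F) where
  f₂ := F.map E.f₂
  g₂ := F.map E.g₂
  a₂ := F.map E.a₂
  b₂ := F.map E.b₂
  f₁ := F.map E.f₁
  g₁ := F.map E.g₁
  a₁ := F.map E.a₁
  b₁ := F.map E.b₁
  f₀ := F.map E.f₀
  g₀ := F.map E.g₀
  a₀ := F.map E.a₀
  b₀ := F.map E.b₀
  exact₂ := (E.col₂.map F).isBinaryShortExact
  exact₁ := (E.col₁.map F).isBinaryShortExact
  exact₀ := (E.col₀.map F).isBinaryShortExact
  comm_top_i := by simp only [BinarySES.map, ← F.map_comp, E.comm_top_i]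
  comm_top_p := by simp only [BinarySES.map, ← F.map_comp, E.comm_top_p]
  comm_top_i' := by simp only [BinarySES.map, ← F.map_comp, E.comm_top_i']
  comm_top_p' := by simp only [BinarySES.map, ← F.map_comp, E.comm_top_p']
  comm_bot_j := by simp only [BinarySES.map, ← F.map_comp, E.comm_bot_j]
  comm_bot_q := by simp only [BinarySES.map, ← F.map_comp, E.comm_bot_q]
  comm_bot_j' := by simp only [BinarySES.map, ← F.map_comp, E.comm_bot_j']
  comm_bot_q' := by simp only [BinarySES.map, ← F.map_comp, E.comm_bot_q']

end BinarySES

/-- The subgroup of Nenashev's relations in the free abelian group on all binary acyclic complexes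
of length 2: diagonal complexes vanish, and `P₀ - P₁ + P₂ = P' - P + P''` for every `3 × 3`-diagram
with rows `P'`, `P`, `P''` and columns `P₂`, `P₁`, `P₀`. -/
def nenashevRelations (C : Type u) [Category.{v} C] [Abelian C] :
    AddSubgroup (FreeAbelianGroup (BinarySES C)) :=
  AddSubgroup.closure
    ({x | ∃ P : BinarySES C, P.IsDiagonal ∧ x = FreeAbelianGroup.of P} ∪
     {x | ∃ (P' P P'' : BinarySES C) (E : BinarySES.Diagram P' P P''),
        x = (FreeAbelianGroup.of E.col₀ - FreeAbelianGroup.of E.col₁ + FreeAbelianGroup.of E.col₂)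
          - (FreeAbelianGroup.of P' - FreeAbelianGroup.of P + FreeAbelianGroup.of P'')})

/-- Nenashev's `K₁`-group of an abelian category. -/
abbrev NenashevK1 (C : Type u) [Category.{v} C] [Abelian C] : Type (max u v) :=
  FreeAbelianGroup (BinarySES C) ⧸ nenashevRelations C

namespace NenashevK1

variable {C : Type u} [Category.{v} C] [Abelian C] {D : Type u'} [Category.{v'} D] [Abelian D]

/-- The class in `K₁` of a binary short exact sequence `M' ⇉ M ⇉ M''`, considered as a complex
supported on `[0, 2]`. -/
def mk {M' M M'' : C} (i j : M' ⟶ M) (p q : M ⟶ M'') (h : IsBinaryShortExact i j p q) :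
    NenashevK1 C :=
  QuotientAddGroup.mk (FreeAbelianGroup.of ⟨M', M, M'', i, j, p, q, h⟩)

/-- The homomorphism induced on `K₁` by an exact functor. -/
def map (F : C ⥤ D) [F.Additive] [PreservesFiniteLimits F] [PreservesFiniteColimits F] :
    NenashevK1 C →+ NenashevK1 D :=
  QuotientAddGroup.map (nenashevRelations C) (nenashevRelations D)
    (FreeAbelianGroup.map (BinarySES.map F)) (by
      rw [nenashevRelations, AddSubgroup.closure_le]
      rintro x (⟨P, hP, rfl⟩ | ⟨P', P, P'', E, rfl⟩)
      · refine AddSubgroup.subset_closure (Or.inl ⟨P.map F, ?_, ?_⟩)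
        · exact ⟨congrArg F.map hP.1, congrArg F.map hP.2⟩
        · exact FreeAbelianGroup.map_of_apply P
      · refine AddSubgroup.subset_closure (Or.inr ⟨P'.map F, P.map F, P''.map F, E.map F, ?_⟩)
        simp only [map_sub, map_add, FreeAbelianGroup.map_of_apply]
        rfl)

end NenashevK1

/-! ### Length and semisimple objects -/

/-- The length of an object of an abelian category: the supremum of the lengths of the chains of
its subobjects, which is the length of a composition series if there is one and `⊤` otherwise. -/
noncomputable def objectLength {A : Type u} [Category.{v} A] [Abelian A] (X : A) : ℕ∞ :=
  Order.height (⊤ : Subobject X)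

/-- The property of being semisimple, i.e. of being a direct sum of finitely many simple objects.
(In an object of finite length, every direct sum decomposition into non-zero objects is finite.) -/
def semisimpleObjects (A : Type u) [Category.{v} A] [Abelian A] : ObjectProperty A :=
  fun X ↦ ∃ (n : ℕ) (S : Fin n → A), (∀ k, Simple (S k)) ∧ Nonempty (X ≅ ⨁ S)

namespace semisimpleObjects

variable {A : Type u} [Category.{v} A] [Abelian A]

/-- An auxiliary inductive form of semisimplicity. -/
inductive Aux : A → Prop
  | zero (X : A) (hX : IsZero X) : Aux X
  | step (X Y S : A) [Simple S] (e : X ≅ Y ⊞ S) (hY : Aux Y) : Aux X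

lemma Aux.of_iso {X Y : A} (e : X ≅ Y) (h : Aux Y) : Aux X := by
  cases h with
  | zero _ hX => exact .zero _ (hX.of_iso e)
  | step _ Z S e' hZ => exact .step _ Z S (e ≪≫ e') hZ

/-- Splitting off the first summand of a finite direct sum. -/
noncomputable def succIso {n : ℕ} (S : Fin (n + 1) → A) :
    ⨁ S ≅ (⨁ fun k : Fin n ↦ S k.succ) ⊞ S 0 where
  hom := biprod.lift (biproduct.lift fun k ↦ biproduct.π S k.succ) (biproduct.π S 0)
  inv := biprod.desc (biproduct.desc fun k ↦ biproduct.ι S k.succ) (biproduct.ι S 0)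
  hom_inv_id := by
    rw [biprod.lift_desc, biproduct.lift_desc, ← biproduct.total, Fin.sum_univ_succ]
    exact add_comm _ _
  inv_hom_id := by
    ext k l
    · by_cases h : k = l
      · subst h; simp
      · simp [biproduct.ι_π_ne S (fun h' ↦ h (Fin.succ_injective _ h')),
          biproduct.ι_π_ne (fun k : Fin n ↦ S k.succ) h]
    · simp [biproduct.ι_π_ne S (Fin.succ_ne_zero k)]
    · simp [biproduct.ι_π_ne S (Fin.succ_ne_zero _).symm]
    · simp

lemma aux_iff (X : A) : semisimpleObjects A X ↔ Aux X := by
  constructor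
  · rintro ⟨n, S, hS, ⟨e⟩⟩
    refine .of_iso e ?_
    clear e
    induction n with
    | zero => exact .zero _ ((IsZero.iff_id_eq_zero _).2 (by ext k; exact k.elim0))
    | succ n ih =>
      have := hS 0
      exact .step _ _ (S 0) (succIso S) (ih _ fun k ↦ hS k.succ)
  · intro h
    induction h with
    | zero X hX =>
      exact ⟨0, Fin.elim0, fun k ↦ k.elim0,
        ⟨hX.iso ((IsZero.iff_id_eq_zero _).2 (by ext k; exact k.elim0))⟩⟩
    | step X Y S e _ ih =>
      obtain ⟨n, T, hT, ⟨e'⟩⟩ := ih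
      refine ⟨n + 1, Fin.cons S T, fun k ↦ ?_, ⟨e ≪≫ ?_⟩⟩
      · refine Fin.cases ?_ (fun k ↦ ?_) k
        · simpa
        · simpa using hT k
      · exact biprod.mapIso e' (Iso.refl S) ≪≫ (succIso (Fin.cons S T : Fin (n + 1) → A)).symm

lemma Aux.biprod {X Y : A} (hX : Aux X) (hY : Aux Y) : Aux (X ⊞ Y) := by
  induction hY with
  | zero Y hY => exact .of_iso (isoBiprodZero hY).symm hX
  | step Y Z S e _ ih =>
    exact .step _ _ S (biprod.mapIso (Iso.refl X) e ≪≫ (biprod.associator X Z S).symm) ih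

lemma Aux.mono_split {X : A} (hX : Aux X) :
    ∀ {Y : A} (f : Y ⟶ X) [Mono f], Aux Y ∧ ∃ r : X ⟶ Y, f ≫ r = 𝟙 Y := by
  induction hX with
  | zero X hX =>
    intro Y f _
    have hY : IsZero Y := IsZero.of_mono f hX
    exact ⟨.zero _ hY, 0, hY.eq_of_src _ _⟩
  | step X Z S e _ ih =>
    intro Y f _
    suffices H : ∀ {Y : A} (f : Y ⟶ Z ⊞ S) [Mono f], Aux Y ∧ ∃ r : Z ⊞ S ⟶ Y, f ≫ r = 𝟙 Y by
      obtain ⟨h, r, hr⟩ := H (f ≫ e.hom)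
      exact ⟨h, e.hom ≫ r, by simpa using hr⟩
    clear! Y
    intro Y f _
    have key : ∀ {W : A} (g : W ⟶ Z ⊞ S) [Mono g], g ≫ biprod.snd = 0 →
        Mono (g ≫ biprod.fst) := by
      intro W g _ hg
      have h : g = (g ≫ biprod.fst) ≫ biprod.inl := by ext <;> simp [hg]
      have : Mono ((g ≫ biprod.fst) ≫ (biprod.inl : Z ⟶ Z ⊞ S)) := by
        rw [← h]
        infer_instance
      exact mono_of_mono _ (biprod.inl : Z ⟶ Z ⊞ S)
    by_cases h : f ≫ biprod.snd = 0
    · have := key f h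
      obtain ⟨hY, r, hr⟩ := ih (f ≫ biprod.fst)
      exact ⟨hY, biprod.fst ≫ r, by simpa using hr⟩
    · have : Epi (f ≫ biprod.snd) := epi_of_nonzero_to_simple h
      have hk : (kernel.ι (f ≫ biprod.snd) ≫ f) ≫ biprod.snd = 0 := by
        rw [Category.assoc, kernel.condition]
      have := key _ hk
      obtain ⟨hK, r, hr⟩ := ih ((kernel.ι (f ≫ biprod.snd) ≫ f) ≫ biprod.fst)
      let T : ShortComplex A := ShortComplex.mk (kernel.ι (f ≫ biprod.snd)) (f ≫ biprod.snd)
        (kernel.condition _)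
      have hT : T.Exact := T.exact_of_f_is_kernel (kernelIsKernel _)
      let σ : T.Splitting := ShortComplex.Splitting.ofExactOfRetraction T hT
        (f ≫ biprod.fst ≫ r) (by simpa [T] using hr) ‹_›
      obtain ⟨t, ht⟩ : ∃ t : S ⟶ Y, (f ≫ biprod.fst ≫ r) ≫ kernel.ι (f ≫ biprod.snd) +
        (f ≫ biprod.snd) ≫ t = 𝟙 Y := ⟨σ.s, σ.id⟩
      refine ⟨.step _ _ S σ.isoBinaryBiproduct hK,
        (biprod.fst ≫ r) ≫ kernel.ι (f ≫ biprod.snd) + biprod.snd ≫ t, ?_⟩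
      rw [← ht]
      simp

instance : (semisimpleObjects A).IsClosedUnderSubobjects where
  prop_of_mono f _ hY := (aux_iff _).2 (((aux_iff _).1 hY).mono_split f).1

instance : (semisimpleObjects A).IsClosedUnderQuotients where
  prop_of_epi {X Y} f _ hX := by
    rw [aux_iff] at hX ⊢
    obtain ⟨-, r, hr⟩ := hX.mono_split (kernel.ι f)
    let T : ShortComplex A := ShortComplex.mk (kernel.ι f) f (kernel.condition _)
    have hT : T.Exact := T.exact_of_f_is_kernel (kernelIsKernel _)
    let σ : T.Splitting := ShortComplex.Splitting.ofExactOfRetraction T hT r hr ‹_›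
    have h : σ.s ≫ f = 𝟙 Y := σ.s_g
    have : Mono (σ.s ≫ f) := by rw [h]; infer_instance
    have : Mono (σ.s : Y ⟶ X) := mono_of_mono σ.s f
    exact (hX.mono_split (σ.s : Y ⟶ X)).1

instance : (semisimpleObjects A).ContainsZero where
  exists_zero := ⟨_, isZero_zero A, (aux_iff _).2 (.zero _ (isZero_zero A))⟩

instance : (semisimpleObjects A).IsClosedUnderFiniteProducts := by
  have : (semisimpleObjects A).IsClosedUnderBinaryProducts := by
    refine .mk' ?_
    rintro X ⟨F, hF⟩
    rw [aux_iff]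
    refine .of_iso (HasLimit.isoOfNatIso (diagramIsoPair F) ≪≫ (biprod.isoProd _ _).symm) ?_
    exact .biprod ((aux_iff _).1 (hF _)) ((aux_iff _).1 (hF _))
  exact .mk'

end semisimpleObjects

/-- The full subcategory of semisimple objects. It is abelian. -/
abbrev SemisimpleSubcategory (A : Type u) [Category.{v} A] [Abelian A] :=
  (semisimpleObjects A).FullSubcategory

section

variable (A : Type u) [Category.{v} A] [Abelian A]

instance : PreservesFiniteLimits (semisimpleObjects A).ι := by
  have := (semisimpleObjects A).preservesKernels_ι
  exact Functor.preservesFiniteLimits_of_preservesKernels _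

instance : PreservesFiniteColimits (semisimpleObjects A).ι := by
  have := (semisimpleObjects A).preservesCokernels_ι
  exact Functor.preservesFiniteColimits_of_preservesCokernels _

/-- The homomorphism `c : K₁(B) ⟶ K₁(A)` induced by the inclusion of the full subcategory `B` of
semisimple objects. -/
noncomputable def devissageMap : NenashevK1 (SemisimpleSubcategory A) →+ NenashevK1 A :=
  NenashevK1.map (semisimpleObjects A).ι

end

/-! For (b), every binary short exact sequence of objects of finite length turns out to have its
class in the image of `c`; the argument takes place in the quotient of `K₁(A)` by that image. There
a pair of isomorphisms `X ⇉ Y`, completed by zero, has class zero: both isomorphisms preserve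
socles, so the class splits into a semisimple contribution and one from the quotients by the socles,
where induction applies (`cls_ofIsos`). Hence a class depends only on the isomorphism types of the
top and of the bottom sequence, taken separately (`cls_eq_of_isos`), and its vanishing can be read
off from the difference of these types in the Grothendieck group of short exact sequences under
direct sum (`sub_mem_devissageSubgroup_iff`).

A filtration `X ⊆ Y ⊆ Z` carries four short exact sequences, and two filtrations on the same objects
are tied together by one Nenashev relation. Padding with degenerate filtrations turns this into an
additivity law for `φ(S) = [S] - [split sequence with the same ends]`: the sequences starting at `X
⟶ Z` and `Y/X ⟶ Z/X` have the same total as those starting at `X ⟶ Y` and `Y ⟶ Z`. For any such `φ`,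
a weighted Jordan–Hölder theorem (`IsCompositionSum.unique`) shows that the sum of `φ` over the
steps of a composition series depends only on the object, say `γ`. By `IsCompositionSum.add`, `φ(X ⟶
Y ⟶ Z) = γ(Y) - γ(X) - γ(Z)`. This involves objects only, so the top and bottom sequences have the
same `φ`, and their difference is trivial.

Part (a) is a length count in `K ⊓ L ⟶ K ⊞ L ⟶ K ⊔ L`, with the same Jordan–Hölder theorem supplying
the uniqueness of length. -/

open scoped ZeroObject

/-! ### Short exact pairs of morphisms -/

/-- `f` and `g` form a short exact sequence. -/
def IsShortExactPair {C : Type u} [Category.{v} C] [Abelian C] {X Y Z : C} (f : X ⟶ Y) (g : Y ⟶ Z) :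
    Prop :=
  ∃ w : f ≫ g = 0, (ShortComplex.mk f g w).ShortExact

namespace IsShortExactPair

variable {C : Type u} [Category.{v} C] [Abelian C] {X Y Z X' Y' Z' : C}
  {f : X ⟶ Y} {g : Y ⟶ Z} {f' : X' ⟶ Y'} {g' : Y' ⟶ Z'}

lemma comp_eq_zero (h : IsShortExactPair f g) : f ≫ g = 0 := h.1

lemma mono (h : IsShortExactPair f g) : Mono f := h.2.mono_f

lemma epi (h : IsShortExactPair f g) : Epi g := h.2.epi_g

lemma exists_lift (h : IsShortExactPair f g) {W : C} (x : W ⟶ Y) (hx : x ≫ g = 0) :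
    ∃ y : W ⟶ X, y ≫ f = x := by
  have := h.mono
  exact ⟨h.2.exact.lift x hx, h.2.exact.lift_f x hx⟩

lemma exists_desc (h : IsShortExactPair f g) {W : C} (x : Y ⟶ W) (hx : f ≫ x = 0) :
    ∃ y : Z ⟶ W, g ≫ y = x := by
  have := h.epi
  exact ⟨h.2.exact.desc x hx, h.2.exact.g_desc x hx⟩

lemma of_lift [Mono f] [Epi g] (w : f ≫ g = 0)
    (h : ∀ {W : C} (x : W ⟶ Y), x ≫ g = 0 → ∃ y : W ⟶ X, y ≫ f = x) : IsShortExactPair f g := by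
  refine ⟨w, .mk' ((ShortComplex.mk f g w).exact_of_f_is_kernel ?_) ‹_› ‹_›⟩
  exact KernelFork.IsLimit.ofι' _ _ fun x hx ↦ ⟨(h x hx).choose, (h x hx).choose_spec⟩

lemma of_desc [Mono f] [Epi g] (w : f ≫ g = 0)
    (h : ∀ {W : C} (x : Y ⟶ W), f ≫ x = 0 → ∃ y : Z ⟶ W, g ≫ y = x) : IsShortExactPair f g := by
  refine ⟨w, .mk' ((ShortComplex.mk f g w).exact_of_g_is_cokernel ?_) ‹_› ‹_›⟩
  exact CokernelCofork.IsColimit.ofπ' _ _ fun x hx ↦ ⟨(h x hx).choose, (h x hx).choose_spec⟩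

lemma of_iso (h : IsShortExactPair f g) (e₁ : X ≅ X') (e₂ : Y ≅ Y') (e₃ : Z ≅ Z')
    (h₁ : f ≫ e₂.hom = e₁.hom ≫ f') (h₂ : g ≫ e₃.hom = e₂.hom ≫ g') : IsShortExactPair f' g' := by
  have w : f' ≫ g' = 0 := by
    rw [← cancel_epi e₁.hom, ← reassoc_of% h₁, ← h₂, reassoc_of% h.comp_eq_zero]
    simp
  exact ⟨w, ShortComplex.shortExact_of_iso
    (ShortComplex.isoMk e₁ e₂ e₃ h₁.symm h₂.symm) h.2⟩

lemma biprod_map (h : IsShortExactPair f g) (h' : IsShortExactPair f' g') :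
    IsShortExactPair (biprod.map f f') (biprod.map g g') := by
  have := h.mono
  have := h'.mono
  have := h.epi
  have := h'.epi
  refine of_lift ?_ fun {W} x hx ↦ ?_
  · ext <;> simp [h.comp_eq_zero, h'.comp_eq_zero]
  · obtain ⟨y, hy⟩ := h.exists_lift (x ≫ biprod.fst) (by
      simpa using congrArg (· ≫ biprod.fst) hx)
    obtain ⟨y', hy'⟩ := h'.exists_lift (x ≫ biprod.snd) (by
      simpa using congrArg (· ≫ biprod.snd) hx)
    exact ⟨biprod.lift y y', by ext <;> simp [hy, hy']⟩

lemma of_isIso_left (f : X ⟶ Y) [IsIso f] (g : Y ⟶ Z) (hZ : IsZero Z) : IsShortExactPair f g := by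
  have : Epi g := ⟨fun _ _ _ ↦ hZ.eq_of_src _ _⟩
  exact of_lift (hZ.eq_of_tgt _ _) fun x _ ↦ ⟨x ≫ inv f, by simp⟩

lemma of_isIso_right (f : X ⟶ Y) (g : Y ⟶ Z) [IsIso g] (hX : IsZero X) : IsShortExactPair f g := by
  have : Mono f := ⟨fun _ _ _ ↦ hX.eq_of_tgt _ _⟩
  exact of_desc (hX.eq_of_src _ _) fun x _ ↦ ⟨inv g ≫ x, by simp⟩

lemma isIso_left (h : IsShortExactPair f g) (hZ : IsZero Z) : IsIso f := by
  have := h.mono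
  obtain ⟨y, hy⟩ := h.exists_lift (𝟙 Y) (hZ.eq_of_tgt _ _)
  exact ⟨y, by rw [← cancel_mono f, Category.assoc, hy]; simp, hy⟩

lemma isIso_right (h : IsShortExactPair f g) (hX : IsZero X) : IsIso g := by
  have := h.epi
  obtain ⟨y, hy⟩ := h.exists_desc (𝟙 Y) (hX.eq_of_src _ _)
  exact ⟨y, hy, by rw [← cancel_epi g, reassoc_of% hy]; simp⟩

lemma inl_snd (X Y : C) : IsShortExactPair (biprod.inl : X ⟶ X ⊞ Y) biprod.snd :=
  of_lift (by simp) fun x hx ↦ ⟨x ≫ biprod.fst, by ext <;> simp [hx]⟩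

lemma cokernel_π (f : X ⟶ Y) [Mono f] : IsShortExactPair f (cokernel.π f) :=
  of_desc (cokernel.condition f) fun x hx ↦ ⟨cokernel.desc f x hx, by simp⟩

lemma kernel_ι (g : Y ⟶ Z) [Epi g] : IsShortExactPair (kernel.ι g) g :=
  of_lift (kernel.condition g) fun x hx ↦ ⟨kernel.lift g x hx, by simp⟩

/-- The third isomorphism theorem: the quotients in a two-step filtration `X ⊆ Y ⊆ Z` form a short
exact sequence. -/
lemma exists_quotients {W T V : C} {f : X ⟶ Y} {g : Y ⟶ Z} {w : Y ⟶ W} {t : Z ⟶ T} {s : Z ⟶ V}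
    (hw : IsShortExactPair f w) (ht : IsShortExactPair (f ≫ g) t) (hs : IsShortExactPair g s) :
    ∃ (k : W ⟶ T) (l : T ⟶ V), w ≫ k = g ≫ t ∧ t ≫ l = s ∧ IsShortExactPair k l := by
  obtain ⟨k, hk⟩ := hw.exists_desc (g ≫ t) (by rw [← Category.assoc, ht.comp_eq_zero])
  obtain ⟨l, hl⟩ := ht.exists_desc s (by rw [Category.assoc, hs.comp_eq_zero, comp_zero])
  have := hw.epi
  have := ht.epi
  have := hs.epi
  have := hs.mono
  have := ht.mono
  have : Epi (t ≫ l) := by rw [hl]; infer_instance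
  have : Epi l := epi_of_epi t l
  have : Mono k := by
    refine Preadditive.mono_of_cancel_zero _ fun {P} x hx ↦ ?_
    -- An element of `Y / X` that dies in `Z / X` is represented, after a cover, by an element of
    -- `Y` lying in `X`.
    obtain ⟨P', π, _, y, hy⟩ := surjective_up_to_refinements_of_epi w x
    obtain ⟨z, hz⟩ := ht.exists_lift (y ≫ g) (by
      rw [Category.assoc, ← hk, ← reassoc_of% hy, hx, comp_zero])
    have : z ≫ f = y := by rw [← cancel_mono g, Category.assoc, hz]
    rw [← cancel_epi π, hy, ← this, Category.assoc, hw.comp_eq_zero, comp_zero, comp_zero]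
  refine ⟨k, l, hk, hl, of_desc ?_ fun {P} x hx ↦ ?_⟩
  · rw [← cancel_epi w, reassoc_of% hk, hl, hs.comp_eq_zero, comp_zero]
  · obtain ⟨y, hy⟩ := hs.exists_desc (t ≫ x) (by rw [← reassoc_of% hk, hx, comp_zero])
    exact ⟨y, by rw [← cancel_epi t, reassoc_of% hl, hy]⟩

/-- If a subobject `k` of a quotient lifts along the quotient map, its preimage is a direct sum. -/
lemma biprod_desc {M Q S R : C} {f : X ⟶ M} {t : M ⟶ Q} {k : S ⟶ Q} {l : Q ⟶ R} {s : S ⟶ M}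
    (h : IsShortExactPair f t) (h' : IsShortExactPair k l) (hs : s ≫ t = k) :
    IsShortExactPair (biprod.desc f s) (t ≫ l) := by
  have := h.mono
  have := h'.mono
  have := h.epi
  have := h'.epi
  have : Mono (biprod.desc f s) := by
    refine Preadditive.mono_of_cancel_zero _ fun {P} x hx ↦ ?_
    have e : (x ≫ biprod.fst) ≫ f + (x ≫ biprod.snd) ≫ s = 0 := by
      rw [← hx, biprod.desc_eq]; simp
    have e₂ : x ≫ biprod.snd = 0 := by
      rw [← cancel_mono k, zero_comp, ← hs]
      simpa [h.comp_eq_zero] using congrArg (· ≫ t) e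
    have e₁ : x ≫ biprod.fst = 0 := by
      rw [← cancel_mono f, zero_comp]
      simpa [e₂] using e
    ext <;> simp [e₁, e₂]
  have := epi_comp t l
  refine of_lift ?_ fun {P} x hx ↦ ?_
  · ext
    · simp [reassoc_of% h.comp_eq_zero]
    · simp [reassoc_of% hs, h'.comp_eq_zero]
  · obtain ⟨y, hy⟩ := h'.exists_lift (x ≫ t) (by simpa using hx)
    obtain ⟨z, hz⟩ := h.exists_lift (x - y ≫ s) (by simp [hs, hy])
    exact ⟨biprod.lift z y, by simp [hz]⟩

end IsShortExactPair

/-! ### Chain conditions, induction on quotients, socles -/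

section FiniteLength

variable {A : Type u} [Category.{v} A] [Abelian A]

lemma wellFoundedLT_subobject {X : A} (hX : objectLength X ≠ ⊤) : WellFoundedLT (Subobject X) :=
  StrictMono.wellFoundedLT (f := Order.height) fun _ _ h ↦
    Order.height_strictMono h ((Order.height_mono le_top).trans_lt hX.lt_top)

lemma wellFoundedGT_subobject {X : A} (hX : objectLength X ≠ ⊤) : WellFoundedGT (Subobject X) := by
  have h : Order.coheight (⊥ : Subobject X) ≠ ⊤ := by
    have : (Order.coheight (⊥ : Subobject X) : WithBot ℕ∞) = Order.height (⊤ : Subobject X) := by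
      rw [Order.coheight_bot_eq_krullDim, Order.height_top_eq_krullDim]
    rwa [WithBot.coe_inj.1 this]
  exact StrictAnti.wellFoundedGT (f := Order.coheight) fun _ _ h' ↦
    Order.coheight_strictAnti h' ((Order.coheight_anti bot_le).trans_lt h.lt_top)

/-- Induction over an abelian category all of whose objects have finite length: a property holds
for all objects if it holds for each object whose proper quotients have it. -/
lemma quotient_induction (hA : ∀ X : A, objectLength X ≠ ⊤) {P : A → Prop}
    (step : ∀ X : A, (∀ (S Q : A) (s : S ⟶ X) (t : X ⟶ Q), IsShortExactPair s t → ¬ IsZero S → P Q) →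
      P X) (X : A) : P X := by
  have := wellFoundedGT_subobject (hA X)
  -- Quotients of the fixed `X` are indexed by their kernels; the ascending chain condition allows
  -- induction from larger kernels to smaller ones.
  have key : ∀ (K : Subobject X) (Q : A) (t : X ⟶ Q), IsShortExactPair K.arrow t → P Q := by
    intro K
    induction K using WellFoundedGT.induction with | _ K ih
    intro Q t ht
    refine step Q fun S Q' s q h hS ↦ ?_
    have := ht.epi
    have := h.epi
    have := h.mono
    have := epi_comp t q
    have hle : K ≤ Subobject.mk (kernel.ι (t ≫ q)) :=
      Subobject.le_mk_of_comm (kernel.lift _ K.arrow (by rw [reassoc_of% ht.comp_eq_zero, zero_comp]))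
        (by simp)
    refine ih _ (lt_of_le_of_ne hle fun he ↦ hS ?_) Q' (t ≫ q) ?_
    -- If the kernel did not grow, a lift to `X` of a cover of `S` would land in `K`, forcing `S` to
    -- vanish.
    · obtain ⟨P', π, _, y, hy⟩ := surjective_up_to_refinements_of_epi t s
      have hy' : y ≫ t ≫ q = 0 := by rw [← reassoc_of% hy, h.comp_eq_zero, comp_zero]
      have hK : K.Factors y := by
        rw [he, Subobject.mk_factors_iff]
        exact ⟨kernel.lift _ y hy', by simp [MonoOver.arrow]⟩
      have : π ≫ s = 0 := by
        rw [hy, ← K.factorThru_arrow y hK, Category.assoc, ht.comp_eq_zero, comp_zero]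
      rw [IsZero.iff_id_eq_zero, ← cancel_epi π, ← cancel_mono s]
      simpa using this
    · exact (IsShortExactPair.kernel_ι (t ≫ q)).of_iso (Subobject.underlyingIso _).symm (Iso.refl _)
        (Iso.refl _) (by simp) (by simp)
  exact key ⊥ X (𝟙 X) (.of_isIso_right _ _ ((isZero_zero A).of_iso Subobject.botCoeIsoZero))

lemma exists_simple_mono (hA : ∀ X : A, objectLength X ≠ ⊤) {X : A} (hX : ¬ IsZero X) :
    ∃ (S : A) (s : S ⟶ X), Simple S ∧ Mono s := by
  have : IsArtinianObject X := ⟨wellFoundedLT_subobject (hA X)⟩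
  obtain ⟨Y, hY⟩ := exists_simple_subobject hX
  exact ⟨_, Y.arrow, hY, inferInstance⟩

/-- The existence of the socle. -/
lemma exists_socle (hA : ∀ X : A, objectLength X ≠ ⊤) (X : A) :
    ∃ (K : A) (k : K ⟶ X), Mono k ∧ semisimpleObjects A K ∧ (IsZero K → IsZero X) ∧
      ∀ (S : A) (x : S ⟶ X), semisimpleObjects A S → ∃ y : S ⟶ K, y ≫ k = x := by
  have := wellFoundedGT_subobject (hA X)
  obtain ⟨K, hK, hmax⟩ := WellFounded.has_min (r := (· > ·))
    (wellFounded_gt (α := Subobject X)) {K | semisimpleObjects A (K : A)} ⟨⊥, by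
      rw [Set.mem_ofPred_eq, semisimpleObjects.aux_iff]
      exact .zero _ ((isZero_zero A).of_iso Subobject.botCoeIsoZero)⟩
  have hfac (S : A) (x : S ⟶ X) (hS : semisimpleObjects A S) : ∃ y : S ⟶ K, y ≫ K.arrow = x := by
    have hsum : semisimpleObjects A ((K : A) ⊞ S) := by
      rw [semisimpleObjects.aux_iff]
      exact .biprod ((semisimpleObjects.aux_iff _).1 hK) ((semisimpleObjects.aux_iff _).1 hS)
    -- The image of `K ⊞ S` is semisimple and contains `K`, so it equals `K` by maximality.
    let d := biprod.desc K.arrow x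
    have hL : semisimpleObjects A (imageSubobject d : A) :=
      (semisimpleObjects A).prop_of_epi (factorThruImageSubobject d) hsum
    have hle : K ≤ imageSubobject d :=
      Subobject.le_of_comm (biprod.inl ≫ factorThruImageSubobject d) (by simp [d])
    have heq : imageSubobject d ≤ K := by
      by_contra hn
      exact hmax _ hL (lt_of_le_not_ge hle hn)
    exact ⟨biprod.inr ≫ factorThruImageSubobject d ≫ Subobject.ofLE _ _ heq, by simp [d]⟩
  refine ⟨K, K.arrow, inferInstance, hK, fun hz ↦ ?_, hfac⟩
  by_contra hX
  obtain ⟨S, s, hS, hs⟩ := exists_simple_mono hA hX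
  obtain ⟨y, hy⟩ := hfac S s <| by
    rw [semisimpleObjects.aux_iff]
    exact .step S 0 S (isoZeroBiprod (isZero_zero A)) (.zero _ (isZero_zero A))
  have hs0 : s = 0 := by rw [← hy, hz.eq_of_tgt y 0, zero_comp]
  refine Simple.not_isZero S ?_
  rw [IsZero.iff_id_eq_zero, ← cancel_mono s, hs0, comp_zero, comp_zero]

end FiniteLength

/-! ### Classes modulo the image of the dévissage map -/

section DevissageCokernel

variable {A : Type u} [Category.{v} A] [Abelian A]

lemma IsShortExactPair.binary {X Y Z : A} {i j : X ⟶ Y} {p q : Y ⟶ Z} (h : IsShortExactPair i p)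
    (h' : IsShortExactPair j q) : IsBinaryShortExact i j p q :=
  ⟨h.1, h'.1, h.2, h'.2⟩

namespace BinarySES

lemma top (P : BinarySES A) : IsShortExactPair P.i P.p :=
  ⟨P.isBinaryShortExact.zero_top, P.isBinaryShortExact.shortExact_top⟩

lemma bot (P : BinarySES A) : IsShortExactPair P.j P.q :=
  ⟨P.isBinaryShortExact.zero_bot, P.isBinaryShortExact.shortExact_bot⟩

/-- The class of a binary short exact sequence in the cokernel of `devissageMap A`. -/
noncomputable def cls (P : BinarySES A) : NenashevK1 A ⧸ (devissageMap A).range :=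
  QuotientAddGroup.mk (QuotientAddGroup.mk (FreeAbelianGroup.of P))

lemma cls_eq_zero_iff (P : BinarySES A) :
    P.cls = 0 ↔ NenashevK1.mk P.i P.j P.p P.q P.isBinaryShortExact ∈ (devissageMap A).range :=
  QuotientAddGroup.eq_zero_iff _

lemma cls_eq_zero_of_isDiagonal {P : BinarySES A} (h : P.IsDiagonal) : P.cls = 0 := by
  have : (QuotientAddGroup.mk (FreeAbelianGroup.of P) : NenashevK1 A) = 0 :=
    (QuotientAddGroup.eq_zero_iff _).2 (AddSubgroup.subset_closure (Or.inl ⟨P, h, rfl⟩))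
  rw [cls, this, QuotientAddGroup.mk_zero]

lemma Diagram.cls_relation {P' P P'' : BinarySES A} (E : Diagram P' P P'') :
    E.col₀.cls - E.col₁.cls + E.col₂.cls = P'.cls - P.cls + P''.cls := by
  have h : ((QuotientAddGroup.mk
      ((FreeAbelianGroup.of E.col₀ - FreeAbelianGroup.of E.col₁ + FreeAbelianGroup.of E.col₂)
        - (FreeAbelianGroup.of P' - FreeAbelianGroup.of P + FreeAbelianGroup.of P''))) :
        NenashevK1 A) = 0 :=
    (QuotientAddGroup.eq_zero_iff _).2
      (AddSubgroup.subset_closure (Or.inr ⟨P', P, P'', E, rfl⟩))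
  have h' := congrArg (QuotientAddGroup.mk (s := (devissageMap A).range)) h
  simp only [QuotientAddGroup.mk_sub, QuotientAddGroup.mk_add, QuotientAddGroup.mk_zero] at h'
  exact sub_eq_zero.1 h'

/-- The inclusion of the semisimple objects is full, faithful and exact, so it reflects short
exactness and the complex lifts to the subcategory. -/
lemma cls_eq_zero_of_semisimple (P : BinarySES A) (h₂ : semisimpleObjects A P.X₂)
    (h₁ : semisimpleObjects A P.X₁) (h₀ : semisimpleObjects A P.X₀) : P.cls = 0 := by
  have key {X Y Z : SemisimpleSubcategory A} {f : X ⟶ Y} {g : Y ⟶ Z}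
      (h : IsShortExactPair f.hom g.hom) : IsShortExactPair f g := by
    have w : f ≫ g = 0 := by ext; exact h.comp_eq_zero
    refine ⟨w, .mk' ?_ ?_ ?_⟩
    · rw [← ShortComplex.exact_map_iff_of_faithful _ (semisimpleObjects A).ι]
      exact h.2.exact
    · exact (semisimpleObjects A).ι.mono_of_mono_map h.mono
    · exact (semisimpleObjects A).ι.epi_of_epi_map h.epi
  let P' : BinarySES (SemisimpleSubcategory A) :=
    { X₂ := ⟨P.X₂, h₂⟩
      X₁ := ⟨P.X₁, h₁⟩
      X₀ := ⟨P.X₀, h₀⟩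
      i := ObjectProperty.homMk P.i
      j := ObjectProperty.homMk P.j
      p := ObjectProperty.homMk P.p
      q := ObjectProperty.homMk P.q
      isBinaryShortExact := (key P.top).binary (key P.bot) }
  rw [cls_eq_zero_iff]
  refine ⟨QuotientAddGroup.mk (FreeAbelianGroup.of P'), ?_⟩
  change QuotientAddGroup.mk (FreeAbelianGroup.map (BinarySES.map (semisimpleObjects A).ι)
    (FreeAbelianGroup.of P')) = _
  rw [FreeAbelianGroup.map_of_apply]
  rfl

/-- A pair of isomorphisms, considered as a binary short exact sequence. -/
def ofIsos {X Y : A} (f g : X ≅ Y) (Z : A) (hZ : IsZero Z) : BinarySES A :=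
  ⟨X, Y, Z, f.hom, g.hom, 0, 0, (IsShortExactPair.of_isIso_left f.hom 0 hZ).binary
    (.of_isIso_left g.hom 0 hZ)⟩

/-- An isomorphism that respects given subobjects induces isomorphisms of the subobjects and of the
quotients. -/
lemma exists_induced_isos {K X Q L Y R : A} {k : K ⟶ X} {t : X ⟶ Q} {l : L ⟶ Y} {s : Y ⟶ R}
    (h : IsShortExactPair k t) (h' : IsShortExactPair l s) (f : X ≅ Y)
    (h₁ : ∃ y, y ≫ l = k ≫ f.hom) (h₂ : ∃ y, y ≫ k = l ≫ f.inv) :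
    ∃ (a : K ≅ L) (b : Q ≅ R), k ≫ f.hom = a.hom ≫ l ∧ t ≫ b.hom = f.hom ≫ s := by
  obtain ⟨y, hy⟩ := h₁
  obtain ⟨z, hz⟩ := h₂
  have := h.mono
  have := h'.mono
  have := h.epi
  have := h'.epi
  obtain ⟨b, hb⟩ := h.exists_desc (f.hom ≫ s) (by
    rw [← reassoc_of% hy, h'.comp_eq_zero, comp_zero])
  obtain ⟨c, hc⟩ := h'.exists_desc (f.inv ≫ t) (by
    rw [← reassoc_of% hz, h.comp_eq_zero, comp_zero])
  refine ⟨⟨y, z, ?_, ?_⟩, ⟨b, c, ?_, ?_⟩, hy.symm, hb⟩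
  · rw [← cancel_mono k, Category.assoc, hz, reassoc_of% hy]; simp
  · rw [← cancel_mono l, Category.assoc, hy, reassoc_of% hz]; simp
  · rw [← cancel_epi t, reassoc_of% hb, hc]; simp
  · rw [← cancel_epi s, reassoc_of% hc, hb]; simp

/-- The socle receives every morphism from a semisimple object, so `f` and `g` both carry the socle
of `X` onto that of `Y`. The socle inclusions and quotient maps give a diagram with diagonal
columns; its first row is semisimple, and its last row is covered by induction because the socle of
a nonzero `X` is nonzero. -/
lemma cls_ofIsos (hA : ∀ X : A, objectLength X ≠ ⊤) {X Y : A} (f g : X ≅ Y) (Z : A)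
    (hZ : IsZero Z) : (ofIsos f g Z hZ).cls = 0 := by
  revert Y Z
  induction X using quotient_induction hA with | step X ih
  intro Y f g Z hZ
  have hz : semisimpleObjects A Z := (semisimpleObjects.aux_iff _).2 (.zero _ hZ)
  obtain ⟨K, k, _, hK, hK0, hkmax⟩ := exists_socle hA X
  obtain ⟨L, l, _, hL, -, hlmax⟩ := exists_socle hA Y
  by_cases hX : IsZero X
  · exact cls_eq_zero_of_semisimple _ ((semisimpleObjects.aux_iff _).2 (.zero _ hX))
      ((semisimpleObjects.aux_iff _).2 (.zero _ (hX.of_iso f.symm))) hz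
  have hk := IsShortExactPair.cokernel_π k
  have hl := IsShortExactPair.cokernel_π l
  obtain ⟨a, b, hfa, hfb⟩ := exists_induced_isos hk hl f (hlmax _ _ hK) (hkmax _ _ hL)
  obtain ⟨c, d, hgc, hgd⟩ := exists_induced_isos hk hl g (hlmax _ _ hK) (hkmax _ _ hL)
  have h0 : IsShortExactPair (0 : Z ⟶ Z) (0 : Z ⟶ Z) := by
    have : IsIso (0 : Z ⟶ Z) := ⟨0, hZ.eq_of_src _ _, hZ.eq_of_src _ _⟩
    exact .of_isIso_left _ _ hZ
  let E : Diagram (ofIsos a c Z hZ) (ofIsos f g Z hZ) (ofIsos b d Z hZ) :=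
    { f₂ := k
      g₂ := k
      a₂ := cokernel.π k
      b₂ := cokernel.π k
      f₁ := l
      g₁ := l
      a₁ := cokernel.π l
      b₁ := cokernel.π l
      f₀ := 0
      g₀ := 0
      a₀ := 0
      b₀ := 0
      exact₂ := hk.binary hk
      exact₁ := hl.binary hl
      exact₀ := h0.binary h0
      comm_top_i := hfa.symm
      comm_top_p := hZ.eq_of_tgt _ _
      comm_top_i' := hfb.symm
      comm_top_p' := hZ.eq_of_tgt _ _
      comm_bot_j := hgc.symm
      comm_bot_q := hZ.eq_of_tgt _ _
      comm_bot_j' := hgd.symm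
      comm_bot_q' := hZ.eq_of_tgt _ _ }
  have h := E.cls_relation
  rw [cls_eq_zero_of_isDiagonal (P := E.col₀) ⟨rfl, rfl⟩,
    cls_eq_zero_of_isDiagonal (P := E.col₁) ⟨rfl, rfl⟩,
    cls_eq_zero_of_isDiagonal (P := E.col₂) ⟨rfl, rfl⟩,
    cls_eq_zero_of_semisimple _ hK hL hz, ih K _ k _ hk (fun h ↦ hX (hK0 h)) b d Z hZ] at h
  simpa using h.symm

/-- Modulo the image of `devissageMap A`, the class of a binary short exact sequence depends only on
the isomorphism classes of its top and of its bottom sequence. -/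
lemma cls_eq_of_isos (hA : ∀ X : A, objectLength X ≠ ⊤) {P P' : BinarySES A}
    (f₂ g₂ : P.X₂ ≅ P'.X₂) (f₁ g₁ : P.X₁ ≅ P'.X₁) (f₀ g₀ : P.X₀ ≅ P'.X₀)
    (hi : P.i ≫ f₁.hom = f₂.hom ≫ P'.i) (hp : P.p ≫ f₀.hom = f₁.hom ≫ P'.p)
    (hj : P.j ≫ g₁.hom = g₂.hom ≫ P'.j) (hq : P.q ≫ g₀.hom = g₁.hom ≫ P'.q) :
    P.cls = P'.cls := by
  have h0 := isZero_zero A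
  let N : BinarySES A := ofIsos (Iso.refl 0) (Iso.refl 0) 0 h0
  -- The columns are pairs of isomorphisms, which vanish by `cls_ofIsos`, and the third row is zero.
  -- The top and bottom isomorphisms need not agree, which is the point of working modulo the image.
  let E : Diagram P P' N :=
    { f₂ := f₂.hom
      g₂ := g₂.hom
      a₂ := (0 : P'.X₂ ⟶ N.X₂)
      b₂ := (0 : P'.X₂ ⟶ N.X₂)
      f₁ := f₁.hom
      g₁ := g₁.hom
      a₁ := (0 : P'.X₁ ⟶ N.X₁)
      b₁ := (0 : P'.X₁ ⟶ N.X₁)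
      f₀ := f₀.hom
      g₀ := g₀.hom
      a₀ := (0 : P'.X₀ ⟶ N.X₀)
      b₀ := (0 : P'.X₀ ⟶ N.X₀)
      exact₂ := (ofIsos f₂ g₂ 0 h0).isBinaryShortExact
      exact₁ := (ofIsos f₁ g₁ 0 h0).isBinaryShortExact
      exact₀ := (ofIsos f₀ g₀ 0 h0).isBinaryShortExact
      comm_top_i := hi
      comm_top_p := hp
      comm_top_i' := h0.eq_of_tgt _ _
      comm_top_p' := h0.eq_of_tgt _ _
      comm_bot_j := hj
      comm_bot_q := hq
      comm_bot_j' := h0.eq_of_tgt _ _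
      comm_bot_q' := h0.eq_of_tgt _ _ }
  have h := E.cls_relation
  rw [show E.col₀.cls = 0 from cls_ofIsos hA f₀ g₀ 0 h0,
    show E.col₁.cls = 0 from cls_ofIsos hA f₁ g₁ 0 h0,
    show E.col₂.cls = 0 from cls_ofIsos hA f₂ g₂ 0 h0,
    cls_eq_zero_of_isDiagonal (P := N) ⟨rfl, rfl⟩] at h
  simpa [sub_eq_zero] using h.symm

/-- The direct sum of binary short exact sequences. -/
noncomputable def sum (P P' : BinarySES A) : BinarySES A :=
  ⟨P.X₂ ⊞ P'.X₂, P.X₁ ⊞ P'.X₁, P.X₀ ⊞ P'.X₀, biprod.map P.i P'.i, biprod.map P.j P'.j,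
    biprod.map P.p P'.p, biprod.map P.q P'.q,
    (P.top.biprod_map P'.top).binary (P.bot.biprod_map P'.bot)⟩

/-- The split inclusions and projections of the summands form a diagram with diagonal columns. -/
lemma cls_sum (P P' : BinarySES A) : (P.sum P').cls = P.cls + P'.cls := by
  have hs (X Y : A) := (IsShortExactPair.inl_snd X Y).binary (.inl_snd X Y)
  let E : Diagram P (P.sum P') P' :=
    { f₂ := biprod.inl
      g₂ := biprod.inl
      a₂ := biprod.snd
      b₂ := biprod.snd
      f₁ := biprod.inl
      g₁ := biprod.inl
      a₁ := biprod.snd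
      b₁ := biprod.snd
      f₀ := biprod.inl
      g₀ := biprod.inl
      a₀ := biprod.snd
      b₀ := biprod.snd
      exact₂ := hs _ _
      exact₁ := hs _ _
      exact₀ := hs _ _
      comm_top_i := by simp [sum]
      comm_top_p := by simp [sum]
      comm_top_i' := by simp [sum]
      comm_top_p' := by simp [sum]
      comm_bot_j := by simp [sum]
      comm_bot_q := by simp [sum]
      comm_bot_j' := by simp [sum]
      comm_bot_q' := by simp [sum] }
  have h := E.cls_relation
  rw [cls_eq_zero_of_isDiagonal (P := E.col₀) ⟨rfl, rfl⟩,
    cls_eq_zero_of_isDiagonal (P := E.col₁) ⟨rfl, rfl⟩,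
    cls_eq_zero_of_isDiagonal (P := E.col₂) ⟨rfl, rfl⟩] at h
  rw [eq_comm, ← sub_eq_zero]
  rw [← eq_comm, ← sub_eq_zero] at h
  rw [← h]
  abel

end BinarySES

end DevissageCokernel

/-! ### The monoids of isomorphism classes of objects and of short exact sequences -/

/-- A short exact sequence. -/
structure ShortExactSeq (C : Type u) [Category.{v} C] [Abelian C] where
  /-- the subobject -/
  X : C
  /-- the middle object -/
  Y : C
  /-- the quotient -/
  Z : C
  /-- the inclusion of the subobject -/
  f : X ⟶ Y
  /-- the projection onto the quotient -/
  g : Y ⟶ Z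
  exact : IsShortExactPair f g

namespace ShortExactSeq

variable {A : Type u} [Category.{v} A] [Abelian A]

/-- Two short exact sequences are isomorphic. -/
def Isomorphic (S T : ShortExactSeq A) : Prop :=
  ∃ (e₁ : S.X ≅ T.X) (e₂ : S.Y ≅ T.Y) (e₃ : S.Z ≅ T.Z),
    S.f ≫ e₂.hom = e₁.hom ≫ T.f ∧ S.g ≫ e₃.hom = e₂.hom ≫ T.g

/-- Isomorphism of short exact sequences is an equivalence relation. -/
instance isomorphicSetoid (A : Type u) [Category.{v} A] [Abelian A] : Setoid (ShortExactSeq A) where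
  r := Isomorphic
  iseqv :=
    { refl := fun S ↦ ⟨Iso.refl _, Iso.refl _, Iso.refl _, by simp, by simp⟩
      symm := fun ⟨e₁, e₂, e₃, h₁, h₂⟩ ↦ ⟨e₁.symm, e₂.symm, e₃.symm,
        by simp [← cancel_epi e₁.hom, ← reassoc_of% h₁],
        by simp [← cancel_epi e₂.hom, ← reassoc_of% h₂]⟩
      trans := fun ⟨e₁, e₂, e₃, h₁, h₂⟩ ⟨e₁', e₂', e₃', h₁', h₂'⟩ ↦
        ⟨e₁ ≪≫ e₁', e₂ ≪≫ e₂', e₃ ≪≫ e₃', by simp [reassoc_of% h₁, h₁'],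
          by simp [reassoc_of% h₂, h₂']⟩ }

/-- The direct sum of short exact sequences. -/
noncomputable def sum (S T : ShortExactSeq A) : ShortExactSeq A :=
  ⟨_, _, _, biprod.map S.f T.f, biprod.map S.g T.g, S.exact.biprod_map T.exact⟩

/-- The short exact sequence `X = X ⟶ 0`. -/
noncomputable def left (X : A) : ShortExactSeq A :=
  ⟨X, X, 0, 𝟙 X, 0, .of_isIso_left _ _ (isZero_zero A)⟩

/-- The short exact sequence `0 ⟶ X = X`. -/
noncomputable def right (X : A) : ShortExactSeq A :=
  ⟨0, X, X, 0, 𝟙 X, .of_isIso_right _ _ (isZero_zero A)⟩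

end ShortExactSeq

/-- The monoid of isomorphism classes of objects under direct sum. -/
def ObjectClass (A : Type u) [Category.{v} A] [Abelian A] : Type u :=
  Quotient (isIsomorphicSetoid A)

/-- The monoid of isomorphism classes of short exact sequences under direct sum. -/
def ShortExactClass (A : Type u) [Category.{v} A] [Abelian A] : Type (max u v) :=
  Quotient (ShortExactSeq.isomorphicSetoid A)

section Classes

variable {A : Type u} [Category.{v} A] [Abelian A]

/-- The isomorphism class of an object. -/
def ObjectClass.mk (X : A) : ObjectClass A := Quotient.mk _ X

lemma ObjectClass.mk_eq_mk {X Y : A} : ObjectClass.mk X = ObjectClass.mk Y ↔ Nonempty (X ≅ Y) :=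
  Quotient.eq

noncomputable instance : Add (ObjectClass A) where
  add := Quotient.map₂ (fun X Y ↦ X ⊞ Y) fun _ _ ⟨e⟩ _ _ ⟨e'⟩ ↦ ⟨biprod.mapIso e e'⟩

noncomputable instance : Zero (ObjectClass A) where
  zero := ObjectClass.mk 0

noncomputable instance : AddCommMonoid (ObjectClass A) where
  nsmul := nsmulRec
  add_assoc := by
    rintro ⟨X⟩ ⟨Y⟩ ⟨Z⟩
    exact Quotient.sound ⟨biprod.associator X Y Z⟩
  zero_add := by
    rintro ⟨X⟩
    exact Quotient.sound ⟨(isoZeroBiprod (isZero_zero A)).symm⟩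
  add_zero := by
    rintro ⟨X⟩
    exact Quotient.sound ⟨(isoBiprodZero (isZero_zero A)).symm⟩
  add_comm := by
    rintro ⟨X⟩ ⟨Y⟩
    exact Quotient.sound ⟨biprod.braiding X Y⟩

lemma ObjectClass.mk_biprod (X Y : A) :
    ObjectClass.mk (X ⊞ Y) = ObjectClass.mk X + ObjectClass.mk Y := rfl

lemma ObjectClass.mk_zero : ObjectClass.mk (0 : A) = 0 := rfl

/-- The isomorphism class of a short exact sequence. -/
def ShortExactClass.mk (S : ShortExactSeq A) : ShortExactClass A := Quotient.mk _ S

lemma ShortExactClass.mk_eq_mk {S T : ShortExactSeq A} :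
    ShortExactClass.mk S = ShortExactClass.mk T ↔ S.Isomorphic T :=
  Quotient.eq

noncomputable instance : Add (ShortExactClass A) where
  add := Quotient.map₂ ShortExactSeq.sum fun _ _ ⟨e₁, e₂, e₃, h₁, h₂⟩ _ _ ⟨e₁', e₂', e₃', h₁', h₂'⟩ ↦
    ⟨biprod.mapIso e₁ e₁', biprod.mapIso e₂ e₂', biprod.mapIso e₃ e₃',
      by dsimp only [ShortExactSeq.sum]; ext <;> simp [h₁, h₁'],
      by dsimp only [ShortExactSeq.sum]; ext <;> simp [h₂, h₂']⟩

noncomputable instance : Zero (ShortExactClass A) where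
  zero := ShortExactClass.mk (ShortExactSeq.left 0)

noncomputable instance : AddCommMonoid (ShortExactClass A) where
  nsmul := nsmulRec
  add_assoc := by
    rintro ⟨X⟩ ⟨Y⟩ ⟨Z⟩
    exact Quotient.sound ⟨biprod.associator _ _ _, biprod.associator _ _ _, biprod.associator _ _ _,
      by dsimp only [ShortExactSeq.sum]; ext <;> simp,
      by dsimp only [ShortExactSeq.sum]; ext <;> simp⟩
  zero_add := by
    rintro ⟨X⟩
    have h := isZero_zero A
    exact Quotient.sound ⟨(isoZeroBiprod h).symm, (isoZeroBiprod h).symm, (isoZeroBiprod h).symm,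
      by dsimp only [ShortExactSeq.sum, ShortExactSeq.left]; ext; simp,
      by dsimp only [ShortExactSeq.sum, ShortExactSeq.left]; ext; simp⟩
  add_zero := by
    rintro ⟨X⟩
    have h := isZero_zero A
    exact Quotient.sound ⟨(isoBiprodZero h).symm, (isoBiprodZero h).symm, (isoBiprodZero h).symm,
      by dsimp only [ShortExactSeq.sum, ShortExactSeq.left]; ext; simp,
      by dsimp only [ShortExactSeq.sum, ShortExactSeq.left]; ext; simp⟩
  add_comm := by
    rintro ⟨X⟩ ⟨Y⟩
    exact Quotient.sound ⟨biprod.braiding _ _, biprod.braiding _ _, biprod.braiding _ _,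
      by dsimp only [ShortExactSeq.sum]; ext <;> simp,
      by dsimp only [ShortExactSeq.sum]; ext <;> simp⟩

lemma ShortExactClass.mk_sum (S T : ShortExactSeq A) :
    ShortExactClass.mk (S.sum T) = ShortExactClass.mk S + ShortExactClass.mk T := rfl

end Classes

/-! ### Top and bottom classes of a binary sequence -/

namespace BinarySES

variable {A : Type u} [Category.{v} A] [Abelian A]

/-- The isomorphism class of the top sequence. -/
def topClass (P : BinarySES A) : ShortExactClass A := .mk ⟨_, _, _, _, _, P.top⟩

/-- The isomorphism class of the bottom sequence. -/
def botClass (P : BinarySES A) : ShortExactClass A := .mk ⟨_, _, _, _, _, P.bot⟩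

/-- The binary short exact sequence with both sequences equal to a given one. -/
def diag (S : ShortExactSeq A) : BinarySES A := ⟨_, _, _, _, _, _, _, S.exact.binary S.exact⟩

/-- Interchanging the top and the bottom sequence. -/
def swap (P : BinarySES A) : BinarySES A := ⟨_, _, _, _, _, _, _, P.bot.binary P.top⟩

lemma topClass_sum (P P' : BinarySES A) : (P.sum P').topClass = P.topClass + P'.topClass := rfl

lemma botClass_sum (P P' : BinarySES A) : (P.sum P').botClass = P.botClass + P'.botClass := rfl

lemma topClass_swap (P : BinarySES A) : P.swap.topClass = P.botClass := rfl

lemma botClass_swap (P : BinarySES A) : P.swap.botClass = P.topClass := rfl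

lemma cls_diag (S : ShortExactSeq A) : (diag S).cls = 0 := cls_eq_zero_of_isDiagonal ⟨rfl, rfl⟩

/-- `cls_eq_of_isos` compares `P` with the diagonal complex on its bottom sequence, using the given
isomorphism on top and the identity below. -/
lemma cls_eq_zero_of_topClass_eq (hA : ∀ X : A, objectLength X ≠ ⊤) {P : BinarySES A}
    (h : P.topClass = P.botClass) : P.cls = 0 := by
  obtain ⟨e₁, e₂, e₃, h₁, h₂⟩ := ShortExactClass.mk_eq_mk.1 h
  rw [← cls_diag ⟨_, _, _, _, _, P.bot⟩]
  exact cls_eq_of_isos hA e₁ (Iso.refl _) e₂ (Iso.refl _) e₃ (Iso.refl _) h₁ h₂ (by simp [diag])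
    (by simp [diag])

lemma cls_swap (hA : ∀ X : A, objectLength X ≠ ⊤) (P : BinarySES A) : P.swap.cls = - P.cls := by
  rw [eq_neg_iff_add_eq_zero, ← cls_sum]
  exact cls_eq_zero_of_topClass_eq hA
    (by rw [topClass_sum, botClass_sum, topClass_swap, botClass_swap, add_comm])

end BinarySES

/-! ### Detecting classes in a Grothendieck group -/

section DevissageSubgroup

variable {A : Type u} [Category.{v} A] [Abelian A]

open Algebra.GrothendieckAddGroup in
/-- The subgroup of the Grothendieck group of the monoid of short exact sequences that is generated
by the differences of the top and the bottom sequence of binary short exact sequences whose class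
lies in the image of `devissageMap A`. -/
noncomputable def devissageSubgroup (hA : ∀ X : A, objectLength X ≠ ⊤) :
    AddSubgroup (Algebra.GrothendieckAddGroup (ShortExactClass A)) where
  carrier := {x | ∃ P : BinarySES A, P.cls = 0 ∧ x = of P.topClass - of P.botClass}
  add_mem' := by
    rintro _ _ ⟨P, hP, rfl⟩ ⟨P', hP', rfl⟩
    refine ⟨P.sum P', by rw [BinarySES.cls_sum, hP, hP', add_zero], ?_⟩
    rw [BinarySES.topClass_sum, BinarySES.botClass_sum, map_add, map_add]
    abel
  zero_mem' := ⟨.diag (.left 0), BinarySES.cls_diag _, (sub_self _).symm⟩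
  neg_mem' := by
    rintro _ ⟨P, hP, rfl⟩
    exact ⟨P.swap, by rw [BinarySES.cls_swap hA, hP, neg_zero], neg_sub _ _⟩

open Algebra.GrothendieckAddGroup in
-- Membership only provides some other `P'` of class zero with the same difference. Equality in the
-- Grothendieck group holds after adding some sequence `S`; then the sum of `diag S`, `P` and the
-- swap of `P'` has isomorphic top and bottom sequences, so its class vanishes, and the class of `P`
-- is all that remains.
lemma BinarySES.sub_mem_devissageSubgroup_iff (hA : ∀ X : A, objectLength X ≠ ⊤)
    (P : BinarySES A) :
    of P.topClass - of P.botClass ∈ devissageSubgroup hA ↔ P.cls = 0 := by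
  refine ⟨?_, fun h ↦ ⟨P, h, rfl⟩⟩
  rintro ⟨P', hP', h⟩
  rw [sub_eq_sub_iff_add_eq_add, ← map_add, ← map_add] at h
  obtain ⟨⟨c, _⟩, hc⟩ := AddLocalization.r_iff_exists.1 (AddLocalization.mk_eq_mk_iff.1 h)
  replace hc : c + (P.topClass + P'.botClass) = c + (P'.topClass + P.botClass) := by
    simpa using hc
  obtain ⟨S, rfl⟩ : ∃ S, ShortExactClass.mk S = c := Quotient.exists_rep c
  have h0 : ((diag S).sum (P.sum P'.swap)).cls = 0 := by
    apply cls_eq_zero_of_topClass_eq hA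
    rw [topClass_sum, topClass_sum, botClass_sum, botClass_sum, topClass_swap, botClass_swap,
      add_comm P.botClass]
    exact hc
  rwa [cls_sum, cls_sum, cls_swap hA, cls_diag, hP', neg_zero, zero_add, add_zero] at h0

end DevissageSubgroup

/-! ### Two-step filtrations and additivity -/

/-- A two-step filtration `X ⊆ Y ⊆ Z` with its quotients `W = Y / X`, `T = Z / X` and
`V = Z / Y`. -/
structure TwoStepFiltration {C : Type u} [Category.{v} C] [Abelian C] (X Y Z W T V : C) where
  ofMaps ::
  /-- the inclusion of `X` into `Y` -/
  f : X ⟶ Y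
  /-- the inclusion of `Y` into `Z` -/
  g : Y ⟶ Z
  /-- the projection onto `Y / X` -/
  w : Y ⟶ W
  /-- the projection onto `Z / X` -/
  t : Z ⟶ T
  /-- the inclusion of `Y / X` into `Z / X` -/
  k : W ⟶ T
  /-- the projection onto `Z / Y` -/
  l : T ⟶ V
  exact_fw : IsShortExactPair f w
  exact_fgt : IsShortExactPair (f ≫ g) t
  exact_gtl : IsShortExactPair g (t ≫ l)
  exact_kl : IsShortExactPair k l
  comm : w ≫ k = g ≫ t

namespace TwoStepFiltration

variable {A : Type u} [Category.{v} A] [Abelian A] {X Y Z W T V X' Y' Z' W' T' V' : A}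

/-- The sequence `X ⟶ Y ⟶ Y / X`. -/
def seqXY (F : TwoStepFiltration X Y Z W T V) : ShortExactSeq A := ⟨_, _, _, _, _, F.exact_fw⟩

/-- The sequence `X ⟶ Z ⟶ Z / X`. -/
def seqXZ (F : TwoStepFiltration X Y Z W T V) : ShortExactSeq A := ⟨_, _, _, _, _, F.exact_fgt⟩

/-- The sequence `Y ⟶ Z ⟶ Z / Y`. -/
def seqYZ (F : TwoStepFiltration X Y Z W T V) : ShortExactSeq A := ⟨_, _, _, _, _, F.exact_gtl⟩

/-- The sequence `Y / X ⟶ Z / X ⟶ Z / Y`. -/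
def seqWT (F : TwoStepFiltration X Y Z W T V) : ShortExactSeq A := ⟨_, _, _, _, _, F.exact_kl⟩

/-- The relation between the classes of the four binary short exact sequences that are formed by two
filtrations with the same underlying objects. -/
lemma cls_relation (F F' : TwoStepFiltration X Y Z W T V) :
    BinarySES.cls ⟨_, _, _, _, _, _, _, F.exact_kl.binary F'.exact_kl⟩
      - BinarySES.cls ⟨_, _, _, _, _, _, _, F.exact_gtl.binary F'.exact_gtl⟩ =
    BinarySES.cls ⟨_, _, _, _, _, _, _, F.exact_fw.binary F'.exact_fw⟩
      - BinarySES.cls ⟨_, _, _, _, _, _, _, F.exact_fgt.binary F'.exact_fgt⟩ := by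
  -- The last row `0 ⇉ V ⇉ V` and the column `X ⇉ X ⇉ 0` are diagonal, so four of the six classes
  -- survive.
  let E : BinarySES.Diagram
      ⟨_, _, _, _, _, _, _, F.exact_fw.binary F'.exact_fw⟩
      ⟨_, _, _, _, _, _, _, F.exact_fgt.binary F'.exact_fgt⟩ (BinarySES.diag (.right V)) :=
    { f₂ := 𝟙 X
      g₂ := 𝟙 X
      a₂ := (0 : X ⟶ 0)
      b₂ := (0 : X ⟶ 0)
      f₁ := F.g
      g₁ := F'.g
      a₁ := F.t ≫ F.l
      b₁ := F'.t ≫ F'.l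
      f₀ := F.k
      g₀ := F'.k
      a₀ := F.l
      b₀ := F'.l
      exact₂ := (ShortExactSeq.left X).exact.binary (ShortExactSeq.left X).exact
      exact₁ := F.exact_gtl.binary F'.exact_gtl
      exact₀ := F.exact_kl.binary F'.exact_kl
      comm_top_i := by simp
      comm_top_p := F.comm
      comm_top_i' := show (F.f ≫ F.g) ≫ F.t ≫ F.l = (0 : X ⟶ 0) ≫ (0 : (0 : A) ⟶ V) by
        rw [Category.assoc, F.exact_gtl.comp_eq_zero, comp_zero, zero_comp]
      comm_top_p' := (Category.comp_id _).symm
      comm_bot_j := by simp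
      comm_bot_q := F'.comm
      comm_bot_j' := show (F'.f ≫ F'.g) ≫ F'.t ≫ F'.l = (0 : X ⟶ 0) ≫ (0 : (0 : A) ⟶ V) by
        rw [Category.assoc, F'.exact_gtl.comp_eq_zero, comp_zero, zero_comp]
      comm_bot_q' := (Category.comp_id _).symm }
  have h := E.cls_relation
  rw [BinarySES.cls_diag, BinarySES.cls_eq_zero_of_isDiagonal (P := E.col₂) ⟨rfl, rfl⟩, add_zero,
    add_zero] at h
  exact h

/-- Transport of a filtration along isomorphisms. -/
lemma exists_transport (F : TwoStepFiltration X' Y' Z' W' T' V') (eX : X ≅ X') (eY : Y ≅ Y')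
    (eZ : Z ≅ Z') (eW : W ≅ W') (eT : T ≅ T') (eV : V ≅ V') :
    ∃ F' : TwoStepFiltration X Y Z W T V, F'.seqXY.Isomorphic F.seqXY ∧
      F'.seqXZ.Isomorphic F.seqXZ ∧ F'.seqYZ.Isomorphic F.seqYZ ∧ F'.seqWT.Isomorphic F.seqWT := by
  refine ⟨⟨eX.hom ≫ F.f ≫ eY.inv, eY.hom ≫ F.g ≫ eZ.inv, eY.hom ≫ F.w ≫ eW.inv,
    eZ.hom ≫ F.t ≫ eT.inv, eW.hom ≫ F.k ≫ eT.inv, eT.hom ≫ F.l ≫ eV.inv,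
    F.exact_fw.of_iso eX.symm eY.symm eW.symm (by simp) (by simp),
    F.exact_fgt.of_iso eX.symm eZ.symm eT.symm (by simp) (by simp),
    F.exact_gtl.of_iso eY.symm eZ.symm eV.symm (by simp) (by simp),
    F.exact_kl.of_iso eW.symm eT.symm eV.symm (by simp) (by simp), by simp [reassoc_of% F.comm]⟩,
    ⟨eX, eY, eW, ?_, ?_⟩, ⟨eX, eZ, eT, ?_, ?_⟩, ⟨eY, eZ, eV, ?_, ?_⟩, ⟨eW, eT, eV, ?_, ?_⟩⟩ <;>
  simp [seqXY, seqXZ, seqYZ, seqWT]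

/-- The direct sum of filtrations. -/
noncomputable def sum (F : TwoStepFiltration X Y Z W T V)
    (F' : TwoStepFiltration X' Y' Z' W' T' V') :
    TwoStepFiltration (X ⊞ X') (Y ⊞ Y') (Z ⊞ Z') (W ⊞ W') (T ⊞ T') (V ⊞ V') where
  f := biprod.map F.f F'.f
  g := biprod.map F.g F'.g
  w := biprod.map F.w F'.w
  t := biprod.map F.t F'.t
  k := biprod.map F.k F'.k
  l := biprod.map F.l F'.l
  exact_fw := F.exact_fw.biprod_map F'.exact_fw
  exact_fgt := by
    convert F.exact_fgt.biprod_map F'.exact_fgt using 1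
    ext <;> simp
  exact_gtl := by
    convert F.exact_gtl.biprod_map F'.exact_gtl using 1
    ext <;> simp
  exact_kl := F.exact_kl.biprod_map F'.exact_kl
  comm := by ext <;> simp [F.comm, F'.comm]

section

variable (F : TwoStepFiltration X Y Z W T V) (F' : TwoStepFiltration X' Y' Z' W' T' V')

open ShortExactClass

lemma mk_seqXZ_sum : mk (F.sum F').seqXZ = mk F.seqXZ + mk F'.seqXZ :=
  mk_eq_mk.2 ⟨Iso.refl _, Iso.refl _, Iso.refl _,
    by dsimp [seqXZ, sum, ShortExactSeq.sum]; ext <;> simp,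
    by dsimp [seqXZ, sum, ShortExactSeq.sum]; ext <;> simp⟩

lemma mk_seqYZ_sum : mk (F.sum F').seqYZ = mk F.seqYZ + mk F'.seqYZ :=
  mk_eq_mk.2 ⟨Iso.refl _, Iso.refl _, Iso.refl _,
    by dsimp [seqYZ, sum, ShortExactSeq.sum]; ext <;> simp,
    by dsimp [seqYZ, sum, ShortExactSeq.sum]; ext <;> simp⟩

end

section

variable (S : ShortExactSeq A)

/-- The filtration `X ⊆ X ⊆ Y` given by a short exact sequence `X ⟶ Y ⟶ Z`. -/
noncomputable def eqLeft : TwoStepFiltration S.X S.X S.Y 0 S.Z S.Z where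
  f := 𝟙 _
  g := S.f
  w := 0
  t := S.g
  k := 0
  l := 𝟙 _
  exact_fw := (ShortExactSeq.left S.X).exact
  exact_fgt := by simpa using S.exact
  exact_gtl := by simpa using S.exact
  exact_kl := (ShortExactSeq.right S.Z).exact
  comm := by simp [S.exact.comp_eq_zero]

/-- The filtration `0 ⊆ X ⊆ Y` given by a short exact sequence `X ⟶ Y ⟶ Z`. -/
noncomputable def zeroLeft : TwoStepFiltration 0 S.X S.Y S.X S.Y S.Z where
  f := 0
  g := S.f
  w := 𝟙 _
  t := 𝟙 _
  k := S.f
  l := S.g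
  exact_fw := (ShortExactSeq.right S.X).exact
  exact_fgt := by rw [zero_comp]; exact (ShortExactSeq.right S.Y).exact
  exact_gtl := by simpa using S.exact
  exact_kl := S.exact
  comm := by simp

/-- The filtration `X ⊆ Y ⊆ Y` given by a short exact sequence `X ⟶ Y ⟶ Z`. -/
noncomputable def eqRight : TwoStepFiltration S.X S.Y S.Y S.Z S.Z 0 where
  f := S.f
  g := 𝟙 _
  w := S.g
  t := S.g
  k := 𝟙 _
  l := 0
  exact_fw := S.exact
  exact_fgt := by simpa using S.exact
  exact_gtl := by rw [comp_zero]; exact (ShortExactSeq.left S.Y).exact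
  exact_kl := (ShortExactSeq.left S.Z).exact
  comm := by simp

open ShortExactClass

lemma mk_seqXZ_eqLeft : mk (eqLeft S).seqXZ = mk S :=
  mk_eq_mk.2 ⟨Iso.refl _, Iso.refl _, Iso.refl _, by simp [seqXZ, eqLeft], by simp [seqXZ, eqLeft]⟩

lemma mk_seqYZ_eqLeft : mk (eqLeft S).seqYZ = mk S :=
  mk_eq_mk.2 ⟨Iso.refl _, Iso.refl _, Iso.refl _, by simp [seqYZ, eqLeft], by simp [seqYZ, eqLeft]⟩

lemma mk_seqXZ_zeroLeft : mk (zeroLeft S).seqXZ = mk (.right S.Y) :=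
  mk_eq_mk.2 ⟨Iso.refl _, Iso.refl _, Iso.refl _, by simp [seqXZ, zeroLeft, ShortExactSeq.right],
    by simp [seqXZ, zeroLeft, ShortExactSeq.right]⟩

lemma mk_seqYZ_zeroLeft : mk (zeroLeft S).seqYZ = mk S :=
  mk_eq_mk.2 ⟨Iso.refl _, Iso.refl _, Iso.refl _, by simp [seqYZ, zeroLeft],
    by simp [seqYZ, zeroLeft]⟩

lemma mk_seqXZ_eqRight : mk (eqRight S).seqXZ = mk S :=
  mk_eq_mk.2 ⟨Iso.refl _, Iso.refl _, Iso.refl _, by simp [seqXZ, eqRight],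
    by simp [seqXZ, eqRight]⟩

lemma mk_seqYZ_eqRight : mk (eqRight S).seqYZ = mk (.left S.Y) :=
  mk_eq_mk.2 ⟨Iso.refl _, Iso.refl _, Iso.refl _, by simp [seqYZ, eqRight, ShortExactSeq.left],
    by simp [seqYZ, eqRight, ShortExactSeq.left]⟩

end

open ShortExactClass Algebra.GrothendieckAddGroup

/-- Once `F'` is transported to the objects of `F`, three of the four classes in `cls_relation`
vanish because their top and bottom sequences are isomorphic; so the fourth vanishes too. -/
lemma seqXZ_sub_mem (hA : ∀ X : A, objectLength X ≠ ⊤) (F : TwoStepFiltration X Y Z W T V)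
    (F' : TwoStepFiltration X' Y' Z' W' T' V') (eX : Nonempty (X ≅ X')) (eY : Nonempty (Y ≅ Y'))
    (eZ : Nonempty (Z ≅ Z')) (eW : Nonempty (W ≅ W')) (eT : Nonempty (T ≅ T'))
    (eV : Nonempty (V ≅ V')) (hXY : mk F.seqXY = mk F'.seqXY) (hYZ : mk F.seqYZ = mk F'.seqYZ)
    (hWT : mk F.seqWT = mk F'.seqWT) :
    of (mk F.seqXZ) - of (mk F'.seqXZ) ∈ devissageSubgroup hA := by
  obtain ⟨F'', h₁, h₂, h₃, h₄⟩ :=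
    F'.exists_transport eX.some eY.some eZ.some eW.some eT.some eV.some
  rw [← mk_eq_mk] at h₁ h₂ h₃ h₄
  rw [← h₁] at hXY
  rw [← h₃] at hYZ
  rw [← h₄] at hWT
  rw [← h₂]
  refine (BinarySES.sub_mem_devissageSubgroup_iff hA
    ⟨_, _, _, _, _, _, _, F.exact_fgt.binary F''.exact_fgt⟩).2 ?_
  have h := F.cls_relation F''
  rw [BinarySES.cls_eq_zero_of_topClass_eq hA (P := ⟨_, _, _, _, _, _, _, _⟩) hXY,
    BinarySES.cls_eq_zero_of_topClass_eq hA (P := ⟨_, _, _, _, _, _, _, _⟩) hYZ,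
    BinarySES.cls_eq_zero_of_topClass_eq hA (P := ⟨_, _, _, _, _, _, _, _⟩) hWT] at h
  simpa using h

/-- The additivity of short exact sequences along a two-step filtration, up to split sequences. -/
lemma sub_mem_devissageSubgroup (hA : ∀ X : A, objectLength X ≠ ⊤)
    (F : TwoStepFiltration X Y Z W T V) :
    of (mk F.seqXZ + mk F.seqWT + mk (.left Y) + mk (.right W)) -
      of (mk F.seqXY + mk (.right T) + mk F.seqYZ + mk (.left W)) ∈ devissageSubgroup hA := by
  let F₁ := ((F.sum (eqLeft F.seqWT)).sum (eqLeft (.left Y))).sum (zeroLeft (.left W))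
  let F₂ := (((eqRight F.seqXY).sum (zeroLeft F.seqWT)).sum (eqLeft F.seqYZ)).sum
    (eqLeft (.left W))
  have hF₁ : mk F₁.seqXZ = mk F.seqXZ + mk F.seqWT + mk (.left Y) + mk (.right W) := by
    rw [mk_seqXZ_sum, mk_seqXZ_sum, mk_seqXZ_sum, mk_seqXZ_eqLeft, mk_seqXZ_eqLeft,
      mk_seqXZ_zeroLeft]
    rfl
  have hF₂ : mk F₂.seqXZ = mk F.seqXY + mk (.right T) + mk F.seqYZ + mk (.left W) := by
    rw [mk_seqXZ_sum, mk_seqXZ_sum, mk_seqXZ_sum, mk_seqXZ_eqLeft, mk_seqXZ_eqLeft,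
      mk_seqXZ_zeroLeft, mk_seqXZ_eqRight]
    rfl
  rw [← hF₁, ← hF₂]
  refine seqXZ_sub_mem hA F₁ F₂ ?_ ?_ ?_ ?_ ?_ ?_ ?_ ?_ ?_
  -- Each comparison of objects becomes an identity in the commutative monoid of isomorphism
  -- classes.
  iterate 6
    focus
      rw [← ObjectClass.mk_eq_mk]
      simp only [ObjectClass.mk_biprod, ObjectClass.mk_zero, ShortExactSeq.left, seqXY, seqYZ,
        seqWT]
      try abel
  · change mk F.seqXY + mk (.left W) + mk (.left Y) + mk (.right W) =
      mk F.seqXY + mk (.right W) + mk (.left Y) + mk (.left W)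
    abel
  · rw [mk_seqYZ_sum, mk_seqYZ_sum, mk_seqYZ_sum, mk_seqYZ_sum, mk_seqYZ_sum, mk_seqYZ_sum]
    simp only [mk_seqYZ_eqLeft, mk_seqYZ_zeroLeft, mk_seqYZ_eqRight]
    change mk F.seqYZ + mk F.seqWT + mk (.left Y) + mk (.left W) =
      mk (.left Y) + mk F.seqWT + mk F.seqYZ + mk (.left W)
    abel
  · change mk F.seqWT + mk (.right V) + mk (.right 0) + mk (.left W) =
      mk (.left W) + mk F.seqWT + mk (.right V) + mk (.right 0)
    abel

end TwoStepFiltration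

/-! ### A weighted Jordan–Hölder theorem -/

section JordanHolder

variable {A : Type u} [Category.{v} A] [Abelian A]

/-- The split short exact sequence `X ⟶ X ⊞ Z ⟶ Z`. -/
noncomputable def ShortExactSeq.split (X Z : A) : ShortExactSeq A := ⟨_, _, _, _, _, .inl_snd X Z⟩

/-- An isomorphism invariant of short exact sequences that vanishes on split sequences and is
additive along two-step filtrations. -/
structure IsFiltrationAdditive {G : Type*} [AddCommGroup G] (φ : ShortExactSeq A → G) : Prop where
  eq_of_isomorphic {S T : ShortExactSeq A} : S.Isomorphic T → φ S = φ T
  split (X Z : A) : φ (.split X Z) = 0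
  add {X Y Z W T V : A} (F : TwoStepFiltration X Y Z W T V) :
    φ F.seqXZ + φ F.seqWT = φ F.seqXY + φ F.seqYZ

lemma IsFiltrationAdditive.eq_zero_of_isZero {G : Type*} [AddCommGroup G] {φ : ShortExactSeq A → G}
    (hφ : IsFiltrationAdditive φ) (S : ShortExactSeq A) (h : IsZero S.X) : φ S = 0 := by
  rw [← hφ.split S.X S.Z]
  have := S.exact.isIso_right h
  refine hφ.eq_of_isomorphic ⟨Iso.refl _, asIso S.g ≪≫ isoZeroBiprod h, Iso.refl _,
    h.eq_of_src _ _, ?_⟩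
  simp [ShortExactSeq.split]

/-- `IsCompositionSum φ n X g` means that `X` has a composition series of length `n` such that the
values of `φ` on the sequences `S ⟶ Y ⟶ Y / S` formed by the steps of the series have sum `g`. -/
inductive IsCompositionSum {G : Type*} [AddCommGroup G] (φ : ShortExactSeq A → G) :
    ℕ → A → G → Prop
  | zero {X : A} (hX : IsZero X) : IsCompositionSum φ 0 X 0
  | step {X S Q : A} {s : S ⟶ X} {t : X ⟶ Q} (h : IsShortExactPair s t) (hS : Simple S) {n : ℕ}
      {g g' : G} (hQ : IsCompositionSum φ n Q g) (hg : g' = g + φ ⟨_, _, _, _, _, h⟩) :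
      IsCompositionSum φ (n + 1) X g'

namespace IsCompositionSum

variable {G : Type*} [AddCommGroup G] {φ : ShortExactSeq A → G}

lemma exists_of_finite (hA : ∀ X : A, objectLength X ≠ ⊤) (φ : ShortExactSeq A → G) (X : A) :
    ∃ n g, IsCompositionSum φ n X g := by
  induction X using quotient_induction hA with | step X ih
  by_cases hX : IsZero X
  · exact ⟨0, 0, .zero hX⟩
  · obtain ⟨S, s, hS, _⟩ := exists_simple_mono hA hX
    obtain ⟨n, g, h⟩ := ih S _ s _ (.cokernel_π s) (Simple.not_isZero S)
    exact ⟨_, _, .step (.cokernel_π s) hS h rfl⟩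

lemma of_iso (hφ : IsFiltrationAdditive φ) {X Y : A} (e : X ≅ Y) {n : ℕ} {g : G}
    (h : IsCompositionSum φ n X g) : IsCompositionSum φ n Y g := by
  cases h with
  | zero hX => exact .zero (hX.of_iso e.symm)
  | step h hS hQ hg =>
    rename_i S Q n g s t
    refine .step (s := s ≫ e.hom) (t := e.inv ≫ t)
      (h.of_iso (Iso.refl _) e (Iso.refl _) (by simp) (by simp)) hS hQ ?_
    rw [hg]
    congr 1
    exact hφ.eq_of_isomorphic ⟨Iso.refl _, e, Iso.refl _, by simp, by simp⟩

/-- Composition series of `X` and `Z` are concatenated. Removing the first simple `S ⊆ X` leaves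
`X/S ⟶ Y/S ⟶ Z`, and additivity along `S ⊆ X ⊆ Y` accounts for the change in the weights. -/
lemma add (hφ : IsFiltrationAdditive φ) {n m : ℕ} {a c : G} {X : A}
    (hX : IsCompositionSum φ n X a) : ∀ {Y Z : A} {f : X ⟶ Y} {g : Y ⟶ Z}
    (h : IsShortExactPair f g) (_ : IsCompositionSum φ m Z c),
    IsCompositionSum φ (m + n) Y (a + c + φ ⟨_, _, _, _, _, h⟩) := by
  induction hX with
  | zero hX =>
    intro Y Z f g h hZ
    have := h.isIso_right hX
    rw [hφ.eq_zero_of_isZero _ hX, add_zero, zero_add, add_zero]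
    exact hZ.of_iso hφ (asIso g).symm
  | step hs hS _ hg ih =>
    rename_i X S Q s t n a' a _
    intro Y Z f g h hZ
    have := h.mono
    have := hs.mono
    have hsf := IsShortExactPair.cokernel_π (s ≫ f)
    obtain ⟨k, l, hk, rfl, hkl⟩ := hs.exists_quotients hsf h
    refine .step hsf hS (ih hkl hZ) ?_
    have := hφ.add ⟨s, f, t, _, k, l, hs, hsf, h, hkl, hk⟩
    rw [hg]
    have e : a' + φ ⟨_, _, _, _, _, hs⟩ + c + φ ⟨_, _, _, _, _, h⟩ =
      a' + c + (φ ⟨_, _, _, _, _, hs⟩ + φ ⟨_, _, _, _, _, h⟩) := by abel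
    rw [e]
    refine Eq.trans (congrArg _ this.symm) ?_
    simp only [TwoStepFiltration.seqXZ, TwoStepFiltration.seqWT]
    abel

/-- The classical exchange argument: two distinct simple subobjects `S`, `S'` span `S ⊞ S'`, and
both series are compared with series through it. The weights match because `φ` is additive along `S
⊆ S ⊞ S' ⊆ X` and `S' ⊆ S ⊞ S' ⊆ X` and vanishes on the split sequences of `S ⊞ S'`. -/
lemma unique (hA : ∀ X : A, objectLength X ≠ ⊤) (hφ : IsFiltrationAdditive φ) {n m : ℕ} {g g' : G}
    {X : A} (h : IsCompositionSum φ n X g) (h' : IsCompositionSum φ m X g') : n = m ∧ g = g' := by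
  have hne {S X Q : A} {s : S ⟶ X} {t : X ⟶ Q} (h : IsShortExactPair s t) (hS : Simple S)
      (hX : IsZero X) : False :=
    have := h.mono
    Simple.not_isZero S (IsZero.of_mono s hX)
  induction n generalizing m g g' X with
  | zero =>
    cases h with | zero hX
    cases h' with
    | zero => exact ⟨rfl, rfl⟩
    | step h hS => exact (hne h hS hX).elim
  | succ n ih =>
    cases h with | step hst hS hQ hg
    cases h' with
    | zero hX => exact (hne hst hS hX).elim
    | step hst' hS' hQ' hg' =>
    rename_i S Q gQ s t S' Q' m gQ' s' t'
    have := hst.mono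
    have := hst'.mono
    by_cases h0 : s' ≫ t = 0
    -- Here `S'` lies in `S`, hence equals it by simplicity, and the quotients `Q`, `Q'` are
    -- isomorphic.
    · obtain ⟨y, hy⟩ := hst.exists_lift s' h0
      have : Mono y := by
        have : Mono (y ≫ s) := by rwa [hy]
        exact mono_of_mono y s
      have hy0 : y ≠ 0 := by
        rintro rfl
        refine Simple.not_isZero S' ?_
        rw [IsZero.iff_id_eq_zero, ← cancel_mono s', ← hy]
        simp
      have := isIso_of_mono_of_nonzero hy0
      obtain ⟨a, b, ha, hb⟩ := BinarySES.exists_induced_isos hst hst' (Iso.refl X)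
        ⟨inv y, by simp [← hy]⟩ ⟨y, by simp [hy]⟩
      obtain ⟨rfl, rfl⟩ := ih (hQ.of_iso hφ b) hQ'
      refine ⟨rfl, ?_⟩
      rw [hg, hg', hφ.eq_of_isomorphic (T := ⟨_, _, _, _, _, hst'⟩) ⟨a, Iso.refl X, b, ha, hb⟩]
    · have : Mono (s' ≫ t) := mono_of_nonzero_from_simple h0
      have hkl := IsShortExactPair.cokernel_π (s' ≫ t)
      -- The cokernel is `X / (S ⊞ S')`; one series of it extends to series of both `Q` and `Q'`, to
      -- which the induction hypothesis applies.
      obtain ⟨r, ρ, hR⟩ := exists_of_finite hA φ (cokernel (s' ≫ t))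
      have hD := hst.biprod_desc hkl rfl
      have hsplit : IsShortExactPair (biprod.inr : S' ⟶ S ⊞ S') biprod.fst :=
        (IsShortExactPair.inl_snd S' S).of_iso (Iso.refl _) (biprod.braiding _ _) (Iso.refl _)
          (by ext <;> simp) (by simp)
      have hst'' : IsShortExactPair (biprod.inr ≫ biprod.desc s s') t' := by simpa using hst'
      have hst₀ : IsShortExactPair (biprod.inl ≫ biprod.desc s s') t := by simpa using hst
      obtain ⟨k', l', hk', hl', hkl'⟩ := hsplit.exists_quotients hst'' hD
      have hD' : IsShortExactPair (biprod.desc s s') (t' ≫ l') := by rwa [hl']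
      obtain ⟨hn, hgQ⟩ := ih hQ (.step hkl hS' hR rfl)
      have hQR' : IsCompositionSum φ n Q' (ρ + φ ⟨_, _, _, _, _, hkl'⟩) := by
        rw [hn]
        exact .step hkl' hS hR rfl
      obtain ⟨rfl, hgQ'⟩ := ih hQR' hQ'
      have e₁ := hφ.add ⟨biprod.inl, biprod.desc s s', biprod.snd, t, s' ≫ t, _, .inl_snd S S', hst₀,
        hD, hkl, by ext <;> simp [hst.comp_eq_zero]⟩
      have e₂ := hφ.add ⟨biprod.inr, biprod.desc s s', biprod.fst, t', k', l', hsplit, hst'',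
        hD', hkl', hk'⟩
      have e₃ : φ ⟨_, _, _, _, _, .inl_snd S S'⟩ = 0 := hφ.split S S'
      have e₄ : φ ⟨_, _, _, _, _, hsplit⟩ = 0 := by
        rw [← hφ.split S' S]
        exact hφ.eq_of_isomorphic ⟨Iso.refl _, biprod.braiding _ _, Iso.refl _,
          by dsimp [ShortExactSeq.split]; ext <;> simp, by simp [ShortExactSeq.split]⟩
      have e₅ : φ ⟨_, _, _, _, _, hst₀⟩ = φ ⟨_, _, _, _, _, hst⟩ :=
        hφ.eq_of_isomorphic ⟨Iso.refl _, Iso.refl _, Iso.refl _, by simp, by simp⟩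
      have e₆ : φ ⟨_, _, _, _, _, hst''⟩ = φ ⟨_, _, _, _, _, hst'⟩ :=
        hφ.eq_of_isomorphic ⟨Iso.refl _, Iso.refl _, Iso.refl _, by simp, by simp⟩
      have e₇ : φ ⟨_, _, _, _, _, hD'⟩ = φ ⟨_, _, _, _, _, hD⟩ :=
        hφ.eq_of_isomorphic ⟨Iso.refl _, Iso.refl _, Iso.refl _, by simp, by simp [hl']⟩
      simp only [TwoStepFiltration.seqXZ, TwoStepFiltration.seqWT, TwoStepFiltration.seqXY,
        TwoStepFiltration.seqYZ] at e₁ e₂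
      rw [e₃, e₅, zero_add] at e₁
      rw [e₄, e₆, e₇, zero_add, ← e₁] at e₂
      refine ⟨rfl, ?_⟩
      rw [hg, hg', ← hgQ', hgQ, add_assoc, add_assoc, add_comm (φ ⟨_, _, _, _, _, hkl'⟩), e₂,
        add_comm (φ ⟨_, _, _, _, _, hkl⟩)]

end IsCompositionSum

/-- The values of a filtration additive invariant depend only on the isomorphism classes of the
objects of a short exact sequence. -/
lemma IsFiltrationAdditive.eq_of_objects (hA : ∀ X : A, objectLength X ≠ ⊤) {G : Type*}
    [AddCommGroup G] {φ : ShortExactSeq A → G} (hφ : IsFiltrationAdditive φ) {X Y Z : A}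
    {f f' : X ⟶ Y} {g g' : Y ⟶ Z} (h : IsShortExactPair f g) (h' : IsShortExactPair f' g') :
    φ ⟨_, _, _, _, _, h⟩ = φ ⟨_, _, _, _, _, h'⟩ := by
  obtain ⟨n, a, hX⟩ := IsCompositionSum.exists_of_finite hA φ X
  obtain ⟨m, c, hZ⟩ := IsCompositionSum.exists_of_finite hA φ Z
  -- Both sequences give composition sums of the same `Y`, differing only in the last term.
  exact add_left_cancel ((hX.add hφ h hZ).unique hA hφ (hX.add hφ h' hZ)).2

end JordanHolder

/-! ### The additive invariant and the image of the dévissage map -/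

section DevissageInvariant

variable {A : Type u} [Category.{v} A] [Abelian A]

open ShortExactClass Algebra.GrothendieckAddGroup

/-- The difference between a short exact sequence and the split short exact sequence with the same
ends, modulo `devissageSubgroup`. -/
noncomputable def devissageInvariant (hA : ∀ X : A, objectLength X ≠ ⊤) (S : ShortExactSeq A) :
    Algebra.GrothendieckAddGroup (ShortExactClass A) ⧸ devissageSubgroup hA :=
  QuotientAddGroup.mk (of (mk S) - of (mk (.left S.X)) - of (mk (.right S.Z)))

/-- Subtracting `left` and `right` kills split sequences, and along a filtration these corrections
combine to exactly the degenerate terms of `TwoStepFiltration.sub_mem_devissageSubgroup`. -/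
lemma isFiltrationAdditive_devissageInvariant (hA : ∀ X : A, objectLength X ≠ ⊤) :
    IsFiltrationAdditive (devissageInvariant hA) where
  eq_of_isomorphic {S T} h := by
    have h' := h
    obtain ⟨e₁, -, e₃, -, -⟩ := h'
    have h₁ : mk (.left S.X) = mk (.left T.X) :=
      mk_eq_mk.2 ⟨e₁, e₁, Iso.refl _, by simp [ShortExactSeq.left], by simp [ShortExactSeq.left]⟩
    have h₃ : mk (.right S.Z) = mk (.right T.Z) :=
      mk_eq_mk.2 ⟨Iso.refl _, e₃, e₃, by simp [ShortExactSeq.right], by simp [ShortExactSeq.right]⟩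
    rw [devissageInvariant, devissageInvariant, h₁, h₃, mk_eq_mk.2 h]
  split X Z := by
    have h : mk (.split X Z) = mk (.left X) + mk (.right Z) := by
      rw [← mk_sum, mk_eq_mk]
      exact ⟨isoBiprodZero (isZero_zero A), Iso.refl _, isoZeroBiprod (isZero_zero A),
        by dsimp [ShortExactSeq.split, ShortExactSeq.sum, ShortExactSeq.left,
            ShortExactSeq.right]; ext <;> simp [isoBiprodZero],
        by dsimp [ShortExactSeq.split, ShortExactSeq.sum, ShortExactSeq.left,
            ShortExactSeq.right]; ext <;> simp [isoZeroBiprod]⟩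
    rw [devissageInvariant, h, map_add]
    change QuotientAddGroup.mk (of (mk (.left X)) + of (mk (.right Z)) - of (mk (.left X))
      - of (mk (.right Z))) = _
    rw [add_sub_cancel_left, sub_self, QuotientAddGroup.mk_zero]
  add {X Y Z W T V} F := by
    have h := F.sub_mem_devissageSubgroup hA
    rw [← sub_eq_zero]
    simp only [devissageInvariant]
    rw [← QuotientAddGroup.mk_add, ← QuotientAddGroup.mk_add, ← QuotientAddGroup.mk_sub,
      QuotientAddGroup.eq_zero_iff]
    convert h using 1
    simp only [map_add]
    change (of (mk F.seqXZ) - of (mk (.left X)) - of (mk (.right T))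
        + (of (mk F.seqWT) - of (mk (.left W)) - of (mk (.right V))))
      - (of (mk F.seqXY) - of (mk (.left X)) - of (mk (.right W))
        + (of (mk F.seqYZ) - of (mk (.left Y)) - of (mk (.right V)))) = _
    abel

/-- If all objects of `A` have finite length, then the class in `K₁(A)` of every binary short exact
sequence lies in the image of the dévissage map: modulo that image, the class depends only on the
isomorphism classes of the top and of the bottom sequence, and their difference vanishes by a
Jordan–Hölder argument. -/
theorem mk_mem_range_devissageMap (hA : ∀ X : A, objectLength X ≠ ⊤) {X Y Z : A} (i j : X ⟶ Y)
    (p q : Y ⟶ Z) (h : IsBinaryShortExact i j p q) :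
    NenashevK1.mk i j p q h ∈ (devissageMap A).range := by
  let P : BinarySES A := ⟨_, _, _, i, j, p, q, h⟩
  refine P.cls_eq_zero_iff.1 ((P.sub_mem_devissageSubgroup_iff hA).1 ?_)
  -- Top and bottom share their ends, so the correction terms cancel and only the difference of the
  -- two classes is left.
  have h := (isFiltrationAdditive_devissageInvariant hA).eq_of_objects hA P.top P.bot
  rw [← sub_eq_zero, devissageInvariant, devissageInvariant, ← QuotientAddGroup.mk_sub,
    QuotientAddGroup.eq_zero_iff, sub_sub_sub_cancel_right, sub_sub_sub_cancel_right] at h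
  exact h

end DevissageInvariant

/-! ### Length and the modular count -/

section Length

variable {A : Type u} [Category.{v} A] [Abelian A]

/-- The object `X` has a composition series of length `n`. -/
def HasLength (n : ℕ) (X : A) : Prop :=
  IsCompositionSum (fun _ : ShortExactSeq A ↦ (0 : PUnit.{1})) n X 0

/-- With weights in the trivial group only the number of steps is recorded, so the weighted theorem
specialises to the usual uniqueness of length. -/
lemma isFiltrationAdditive_zero : IsFiltrationAdditive (fun _ : ShortExactSeq A ↦ (0 : PUnit.{1})) :=
  ⟨fun _ ↦ rfl, fun _ _ ↦ rfl, fun _ ↦ rfl⟩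

namespace HasLength

lemma exists_of_finite (hA : ∀ X : A, objectLength X ≠ ⊤) (X : A) : ∃ n, HasLength n X := by
  obtain ⟨n, _, h⟩ := IsCompositionSum.exists_of_finite hA (fun _ : ShortExactSeq A ↦ (0 : PUnit.{1})) X
  exact ⟨n, h⟩

lemma add {n m : ℕ} {X Y Z : A} {f : X ⟶ Y} {g : Y ⟶ Z} (h : IsShortExactPair f g)
    (hX : HasLength n X) (hZ : HasLength m Z) : HasLength (m + n) Y :=
  IsCompositionSum.add isFiltrationAdditive_zero hX h hZ

lemma of_iso {n : ℕ} {X Y : A} (e : X ≅ Y) (h : HasLength n X) : HasLength n Y :=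
  IsCompositionSum.of_iso isFiltrationAdditive_zero e h

lemma unique (hA : ∀ X : A, objectLength X ≠ ⊤) {n m : ℕ} {X : A} (h : HasLength n X)
    (h' : HasLength m X) : n = m :=
  (IsCompositionSum.unique hA isFiltrationAdditive_zero h h').1

lemma isZero {X : A} (h : HasLength 0 X) : IsZero X := by
  cases h
  assumption

end HasLength

lemma hasLength_one_iff {X : A} : HasLength 1 X ↔ Simple X := by
  constructor
  · intro h
    cases h with | step h hS hQ hg
    rename_i S Q g s t
    have := h.isIso_left (HasLength.isZero hQ)
    exact Simple.of_iso (asIso s).symm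
  · intro h
    exact .step (.of_isIso_left (𝟙 X) (0 : X ⟶ 0) (isZero_zero A)) h (.zero (isZero_zero A)) rfl

lemma Subobject.le_iff_exists_desc {X : A} (K L : Subobject X) :
    K ≤ L ↔ ∃ d, cokernel.π K.arrow ≫ d = cokernel.π L.arrow := by
  constructor
  · intro h
    exact (IsShortExactPair.cokernel_π K.arrow).exists_desc _ (by
      rw [← Subobject.ofLE_arrow h, Category.assoc, cokernel.condition, comp_zero])
  · rintro ⟨d, hd⟩
    obtain ⟨y, hy⟩ := (IsShortExactPair.cokernel_π L.arrow).exists_lift K.arrow (by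
      rw [← hd, cokernel.condition_assoc, zero_comp])
    exact Subobject.le_of_comm y hy

/-- The preimage of a subobject is a strictly monotone function on the subobjects of a quotient. -/
lemma strictMono_kernelSubobject {X Q : A} (t : X ⟶ Q) [Epi t] :
    StrictMono fun K : Subobject Q ↦ Subobject.mk (kernel.ι (t ≫ cokernel.π K.arrow)) := by
  have key (K L : Subobject Q) : Subobject.mk (kernel.ι (t ≫ cokernel.π K.arrow)) ≤
      Subobject.mk (kernel.ι (t ≫ cokernel.π L.arrow)) ↔ K ≤ L := by
    rw [Subobject.le_iff_exists_desc K L]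
    constructor
    · intro h
      obtain ⟨d, hd⟩ := (IsShortExactPair.kernel_ι (t ≫ cokernel.π K.arrow)).exists_desc
        (t ≫ cokernel.π L.arrow) (by
          rw [← Subobject.ofMkLEMk_comp h, Category.assoc, kernel.condition, comp_zero])
      exact ⟨d, by rw [← cancel_epi t, ← hd, Category.assoc]⟩
    · rintro ⟨d, hd⟩
      exact Subobject.mk_le_mk_of_comm (kernel.lift _ (kernel.ι _) (by
        rw [← hd, ← Category.assoc t, kernel.condition_assoc, zero_comp])) (by simp)
  intro K L h
  rw [lt_iff_le_not_ge] at h ⊢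
  simpa [key] using h

/-- The number of composition factors is strictly monotone on subobjects, which bounds chains above
by `n`. Conversely, a chain of length `n - 1` in the quotient by a simple subobject is pulled back
to `X` and extended by `⊥`. -/
lemma HasLength.objectLength_eq (hA : ∀ X : A, objectLength X ≠ ⊤) {n : ℕ} {X : A}
    (h : HasLength n X) : objectLength X = n := by
  apply le_antisymm
  · choose len hlen using HasLength.exists_of_finite hA
    have hmono : StrictMono fun K : Subobject X ↦ len (K : A) := by
      intro K L hKL
      have hs := IsShortExactPair.cokernel_π (Subobject.ofLE K L hKL.le)
      have hL := (hlen L).unique hA ((hlen K).add hs (hlen _))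
      refine lt_of_le_of_ne (by simp only; omega) fun he ↦ hKL.not_ge ?_
      have h0 : len (cokernel (Subobject.ofLE K L hKL.le)) = 0 := by simp only at he; omega
      have hz := hlen (cokernel (Subobject.ofLE K L hKL.le))
      rw [h0] at hz
      have := hs.isIso_left hz.isZero
      exact Subobject.le_of_comm (inv (Subobject.ofLE K L hKL.le)) (by simp)
    have htop : len ((⊤ : Subobject X) : A) = n :=
      (hlen _).unique hA (h.of_iso (asIso (⊤ : Subobject X).arrow).symm)
    have := Order.height_le_height_apply_of_strictMono _ hmono ⊤
    rw [objectLength]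
    simpa [htop] using this
  · induction n generalizing X with
    | zero => simp
    | succ n ih =>
      cases h with | step h hS hQ hg
      rename_i S Q g s t
      have := h.mono
      have := h.epi
      obtain ⟨p, hp, hpn⟩ := Order.exists_series_of_le_height _ (ih hQ)
      let p' := p.map _ (strictMono_kernelSubobject t)
      -- The preimage of any subobject of `Q` contains the nonzero `S`.
      have hlt : ⊥ < p'.head := by
        rw [bot_lt_iff_ne_bot]
        intro he
        replace he : Subobject.mk (kernel.ι (t ≫ cokernel.π p.head.arrow)) = ⊥ := by simpa [p'] using he
        rw [Subobject.mk_eq_bot_iff_zero] at he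
        obtain ⟨y, hy⟩ := (IsShortExactPair.kernel_ι (t ≫ cokernel.π p.head.arrow)).exists_lift s (by
          rw [reassoc_of% h.comp_eq_zero, zero_comp])
        refine Simple.not_isZero S ?_
        rw [IsZero.iff_id_eq_zero, ← cancel_mono s, ← hy, he]
        simp
      have := Order.length_le_height (p := p'.cons ⊥ hlt) (x := ⊤) le_top
      rw [objectLength]
      simpa [p', hpn] using this

/-- The short exact sequence `K ⊓ L ⟶ K ⊞ L ⟶ K ⊔ L`. -/
lemma Subobject.exists_isShortExactPair_inf_sup {X : A} (K L : Subobject X) :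
    ∃ (f : ((K ⊓ L : Subobject X) : A) ⟶ (K : A) ⊞ (L : A))
      (g : (K : A) ⊞ (L : A) ⟶ ((K ⊔ L : Subobject X) : A)), IsShortExactPair f g := by
  let g : (K : A) ⊞ (L : A) ⟶ ((K ⊔ L : Subobject X) : A) :=
    biprod.desc (Subobject.ofLE _ _ le_sup_left) (Subobject.ofLE _ _ le_sup_right)
  let f : ((K ⊓ L : Subobject X) : A) ⟶ (K : A) ⊞ (L : A) :=
    biprod.lift (Subobject.ofLE _ _ inf_le_left) (-Subobject.ofLE _ _ inf_le_right)
  let d : (K : A) ⊞ (L : A) ⟶ X := biprod.desc K.arrow L.arrow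
  have hd : g ≫ (K ⊔ L).arrow = d := by ext <;> simp [g, d]
  -- The join is the image of `K ⊞ L ⟶ X`, which makes `g` an epimorphism.
  have hle : K ⊔ L ≤ imageSubobject d :=
    sup_le (Subobject.le_of_comm (biprod.inl ≫ factorThruImageSubobject d) (by simp [d]))
      (Subobject.le_of_comm (biprod.inr ≫ factorThruImageSubobject d) (by simp [d]))
  have he : g ≫ Subobject.ofLE _ _ hle = factorThruImageSubobject d := by
    rw [← cancel_mono (imageSubobject d).arrow]
    simp [hd]
  have : Epi (g ≫ Subobject.ofLE _ _ hle) := by rw [he]; infer_instance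
  have : Epi (Subobject.ofLE _ _ hle) := epi_of_epi g _
  have : IsIso (Subobject.ofLE _ _ hle) := isIso_of_mono_of_epi _
  have : Epi g := by
    rw [← IsIso.eq_comp_inv] at he
    rw [he]
    infer_instance
  have : Mono f := by
    have : Mono (f ≫ biprod.fst) := by simp only [f, biprod.lift_fst]; infer_instance
    exact mono_of_mono f biprod.fst
  refine ⟨f, g, .of_lift ?_ fun {W} z hz ↦ ?_⟩
  · rw [← cancel_mono (K ⊔ L).arrow, Category.assoc, hd]
    simp [f, d]
  · have hz' : (z ≫ biprod.fst) ≫ K.arrow = -((z ≫ biprod.snd) ≫ L.arrow) := by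
      have : z ≫ d = 0 := by rw [← hd, reassoc_of% hz, zero_comp]
      rw [← add_eq_zero_iff_eq_neg, ← this]
      simp [d, biprod.desc_eq]
    have hfac : (K ⊓ L).Factors ((z ≫ biprod.fst) ≫ K.arrow) := by
      rw [Subobject.inf_factors]
      refine ⟨Subobject.factors_comp_arrow _, ?_⟩
      rw [hz', ← Preadditive.neg_comp]
      exact Subobject.factors_comp_arrow _
    refine ⟨(K ⊓ L).factorThru _ hfac, ?_⟩
    ext
    · simp [f]
    · simpa [f, neg_eq_iff_eq_neg] using hz'

/-- For two subobjects whose lengths add up to the length of the ambient object, their intersection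
is simple if and only if the quotient by their sum is simple. -/
lemma simple_inf_iff_simple_cokernel_sup (hA : ∀ X : A, objectLength X ≠ ⊤) {X : A} {m n : ℕ}
    {K L : Subobject X} (hK : HasLength m (K : A)) (hL : HasLength n (L : A))
    (hX : HasLength (m + n) X) :
    Simple ((K ⊓ L : Subobject X) : A) ↔ Simple (cokernel (K ⊔ L).arrow) := by
  obtain ⟨f, g, h⟩ := Subobject.exists_isShortExactPair_inf_sup K L
  obtain ⟨a, ha⟩ := HasLength.exists_of_finite hA ((K ⊓ L : Subobject X) : A)
  obtain ⟨b, hb⟩ := HasLength.exists_of_finite hA ((K ⊔ L : Subobject X) : A)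
  obtain ⟨c, hc⟩ := HasLength.exists_of_finite hA (cokernel (K ⊔ L).arrow)
  have h₁ := (ha.add h hb).unique hA (hK.add (.inl_snd _ _) hL)
  have h₂ := (hb.add (.cokernel_π _) hc).unique hA hX
  -- The length of the join cancels: `b + a = n + m` and `c + b = m + n`.
  have hac : a = c := by omega
  subst hac
  rw [← hasLength_one_iff, ← hasLength_one_iff]
  constructor
  · intro h
    rwa [ha.unique hA h] at hc
  · intro h
    rwa [hc.unique hA h] at ha

end Length

/-! ### The theorem -/

theorem mainTheorem3 {A : Type u} [Category.{v} A] [Abelian A]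
    (hA : ∀ X : A, objectLength X ≠ ⊤)
    {M' M M'' : A} (i j : M' ⟶ M) (p q : M ⟶ M'') (h : IsBinaryShortExact i j p q)
    (hM : objectLength M ≤ 6) (U : Subobject M) (hU : U = imageSubobject i ⊓ imageSubobject j) :
    (objectLength M' = 3 → objectLength M'' = 3 →
      (Simple (U : A) ↔ Simple (cokernel (imageSubobject i ⊔ imageSubobject j).arrow))) ∧
    (¬ (objectLength M' = 3 ∧ objectLength M'' = 3 ∧ Simple (U : A) ∧
        IsZero (((Subobject.pullback i).obj U ⊓ (Subobject.pullback j).obj U : Subobject M') : A) ∧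
        IsZero (cokernel (imageSubobject (j ≫ p) ⊔ imageSubobject (i ≫ q)).arrow)) →
      NenashevK1.mk i j p q h ∈ (devissageMap A).range) := by
  refine ⟨fun h' h'' ↦ ?_, fun _ ↦ mk_mem_range_devissageMap hA i j p q h⟩
  subst hU
  have hlen {X : A} (hX : objectLength X = 3) : HasLength 3 X := by
    obtain ⟨n, hn⟩ := HasLength.exists_of_finite hA X
    have : (n : ℕ∞) = (3 : ℕ) := by rw [← hn.objectLength_eq hA, hX]; rfl
    rwa [Nat.cast_inj.1 this] at hn
  have htop : IsShortExactPair i p := ⟨h.zero_top, h.shortExact_top⟩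
  have hbot : IsShortExactPair j q := ⟨h.zero_bot, h.shortExact_bot⟩
  -- Both images are copies of `M'`, so their lengths add up to the length `3 + 3` of `M`.
  have him {f : M' ⟶ M} (hf : Mono f) : HasLength 3 (imageSubobject f : A) := by
    rw [imageSubobject_mono]
    exact (hlen h').of_iso (Subobject.underlyingIso f).symm
  exact simple_inf_iff_simple_cokernel_sup hA (him htop.mono) (him hbot.mono)
    ((hlen h').add htop (hlen h''))
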